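/- Let $\mathtt Z$ be a finite set with $|\mathtt Z|=21$, and regard its power set $\operatorname{Pow}(\mathtt Z)$ as an $\mathbb F_2$-vector space with addition $A+B=(A\cup B)\setminus(A\cap B)$. A code is an $\mathbb F_2$-linear subspace $\mathtt C\subset\operatorname{Pow}(\mathtt Z)$. Two codes $\mathtt C,\mathtt C'$ are called $\mathfrak S_{21}$-equivalent if there is a permutation $\tau$ of $\mathtt Z$ with $\tau(\mathtt C)=\mathtt C'$. For $\sigma=1,\dots,10$ let $r(\sigma)$ be the number of $\mathfrak S_{21}$-equivalence classes of codes $\mathtt C$ with $\dim_{\mathbb F_2}\mathtt C=11-\sigma$ that satisfy (b) $\mathtt Z\in\mathtt C$, and (c) $|A|\in\{0,5,8,9,12,13,16,21\}$ for every $A\in\mathtt C$. Then $r(\sigma)$ is given by $$ \begin{array}{c|cccccccccc} \sigma & 1 & 2 & 3 & 4 & 5 & 6 & 7 & 8 & 9 & 10\\ \hline r(\sigma) & 1 & 3 & 13 & 41 & 58 & 43 & 21 & 8 & 3 & 1 \end{array} $$ -/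

import Mathlib

/-- The power set `Pow(Z)` of a finite set `Z`; addition is symmetric difference
(`AsBoolRing` turns a Boolean algebra into a ring with `A + B = A ∆ B`). -/
abbrev PowSet (Z : Type*) [Fintype Z] [DecidableEq Z] := AsBoolRing (Finset Z)

/-- `Pow(Z)` as a vector space over the field with two elements. -/
instance PowSet.instModule (Z : Type*) [Fintype Z] [DecidableEq Z] : Module (ZMod 2) (PowSet Z) :=
  AddCommGroup.zmodModule (n := 2) fun A => by
    rw [two_nsmul]
    exact BooleanRing.add_self A

/-- A code is a linear subspace of `Pow(Z)`; its elements are called words. -/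
abbrev Code (Z : Type*) [Fintype Z] [DecidableEq Z] := Submodule (ZMod 2) (PowSet Z)

namespace Code

variable {Z : Type*} [Fintype Z] [DecidableEq Z]

/-- The image `τ(A)` of a word `A` under a permutation `τ` of `Z`. -/
def permWord (τ : Equiv.Perm Z) (A : PowSet Z) : PowSet Z :=
  toBoolRing ((ofBoolRing A).map τ.toEmbedding)

theorem permWord_one (A : PowSet Z) : permWord 1 A = A := by
  apply ofBoolRing.injective
  ext x
  simp [permWord]
  exact Iff.rfl

theorem permWord_mul (τ ρ : Equiv.Perm Z) (A : PowSet Z) :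
    permWord (τ * ρ) A = permWord τ (permWord ρ A) := by
  apply ofBoolRing.injective
  ext x
  simp [permWord]
  exact Iff.rfl

/-- Two codes `C` and `C'` are equivalent if `τ(C) = C'` for some permutation `τ` of `Z`. -/
def PermEquiv (C C' : Code Z) : Prop :=
  ∃ τ : Equiv.Perm Z, permWord τ '' (C : Set (PowSet Z)) = (C' : Set (PowSet Z))

/-- Equivalence of codes under permutations of `Z`, as an equivalence relation. -/
def permSetoid (Z : Type*) [Fintype Z] [DecidableEq Z] : Setoid (Code Z) where
  r := PermEquiv
  iseqv :=
    { refl := fun C => ⟨1, by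
        have h : (permWord 1 : PowSet Z → PowSet Z) = id := funext permWord_one
        rw [h, Set.image_id]⟩
      symm := by
        rintro C C' ⟨τ, h⟩
        refine ⟨τ⁻¹, ?_⟩
        have h' : (fun A : PowSet Z => permWord τ⁻¹ (permWord τ A)) = id := by
          funext A
          rw [← permWord_mul, inv_mul_cancel, permWord_one, id]
        rw [← h, Set.image_image, h', Set.image_id]
      trans := by
        rintro C C' C'' ⟨τ, h⟩ ⟨ρ, h'⟩
        refine ⟨ρ * τ, ?_⟩
        rw [← h', ← h, Set.image_image]
        exact Set.image_congr fun A _ => permWord_mul ρ τ A }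

/-- The word `Z` belongs to the code. -/
def ContainsFull (C : Code Z) : Prop :=
  toBoolRing (Finset.univ : Finset Z) ∈ C

/-- Every word of the code has cardinality `0, 5, 8, 9, 12, 13, 16` or `21`. -/
def WeightsAllowed (C : Code Z) : Prop :=
  ∀ A ∈ C, (ofBoolRing A).card ∈ ({0, 5, 8, 9, 12, 13, 16, 21} : Finset ℕ)

/-- `r(σ)`: the number of equivalence classes of codes of dimension `11 - σ` that contain the
word `Z` and all of whose words have an allowed cardinality. -/
noncomputable def r (Z : Type*) [Fintype Z] [DecidableEq Z] (σ : ℕ) : ℕ :=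
  Set.ncard {c : Quotient (permSetoid Z) | ∃ C : Code Z,
    Quotient.mk (permSetoid Z) C = c ∧
      Module.finrank (ZMod 2) C + σ = 11 ∧ ContainsFull C ∧ WeightsAllowed C}

end Code

/-! # Classification of the codes

The even words of a code form a code with weights `8`, `12` and `16`. The columns of a generator
matrix turn equivalence of such codes into equivalence of multisets of `21` vectors under linear
maps. These multisets are classified by induction on the dimension: projecting from a nonzero column
of largest multiplicity gives a multiset of smaller dimension, and all ways to lift it are found by
an exhaustive search, each result of which is identified by a linear map with a representative. The
representatives are told apart by numerical invariants. -/

namespace ColumnMultiset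

open Module

variable {V W : Type*} [AddCommGroup V] [Module (ZMod 2) V] [AddCommGroup W] [Module (ZMod 2) W]

/-- The number of columns in `S` on which the functional `φ` does not vanish. -/
def wt (S : Multiset V) (φ : Dual (ZMod 2) V) : ℕ := (S.map fun x => (φ x).val).sum

/-- Every nonzero functional has weight `8`, `12` or `16` on `S`. -/
def Admissible (S : Multiset V) : Prop :=
  ∀ φ : Dual (ZMod 2) V, φ ≠ 0 → wt S φ = 8 ∨ wt S φ = 12 ∨ wt S φ = 16

theorem wt_map (S : Multiset V) (L : V →ₗ[ZMod 2] W) (φ : Dual (ZMod 2) W) :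
    wt (S.map L) φ = wt S (φ ∘ₗ L) := by
  simp [wt, Multiset.map_map]

theorem wt_zero (S : Multiset V) : wt S 0 = 0 := by
  simp [wt]

theorem Admissible.map {S : Multiset V} (h : Admissible S) {L : V →ₗ[ZMod 2] W}
    (hL : Function.Surjective L) : Admissible (S.map L) := by
  intro φ hφ
  rw [wt_map]
  refine h _ fun h0 => hφ ?_
  ext x
  obtain ⟨y, rfl⟩ := hL x
  exact LinearMap.congr_fun h0 y

theorem Admissible.surjective {S : Multiset V} {L : V →ₗ[ZMod 2] W}
    (h : Admissible (S.map L)) : Function.Surjective L := by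
  rw [← LinearMap.dualMap_injective_iff, injective_iff_map_eq_zero]
  intro φ hφ
  by_contra h0
  have := h φ h0
  rw [wt_map, show φ ∘ₗ L = 0 from hφ, wt_zero] at this
  omega

theorem Admissible.bijective [Module.Finite (ZMod 2) V] [Module.Finite (ZMod 2) W]
    {S : Multiset V} {L : V →ₗ[ZMod 2] W}
    (h : Admissible (S.map L)) (hd : finrank (ZMod 2) V = finrank (ZMod 2) W) :
    Function.Bijective L :=
  ⟨(LinearMap.injective_iff_surjective_of_finrank_eq_finrank hd).2 h.surjective, h.surjective⟩

theorem Admissible.four_dvd {S : Multiset V} (h : Admissible S) (φ : Dual (ZMod 2) V) :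
    4 ∣ wt S φ := by
  by_cases h0 : φ = 0
  · simp [h0, wt_zero]
  · rcases h φ h0 with h | h | h <;> rw [h] <;> norm_num

theorem val_add_val (a b : ZMod 2) : a.val + b.val = (a + b).val + 2 * (a * b).val := by
  revert a b; decide

/-- Distinct words of a doubly even code meet in an even number of positions. -/
theorem Admissible.two_dvd_inter {S : Multiset V} (h : Admissible S) (φ ψ : Dual (ZMod 2) V) :
    2 ∣ (S.map fun x => (φ x * ψ x).val).sum := by
  have key : wt S φ + wt S ψ = wt S (φ + ψ) + 2 * (S.map fun x => (φ x * ψ x).val).sum := by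
    simp only [wt, ← Multiset.sum_map_mul_left, ← Multiset.sum_map_add, LinearMap.add_apply,
      val_add_val]
  have h1 := h.four_dvd φ
  have h2 := h.four_dvd ψ
  have h3 := h.four_dvd (φ + ψ)
  omega

theorem Admissible.exists_ne_zero {S : Multiset V} (h : Admissible S) [Module.Finite (ZMod 2) V]
    (hV : 0 < finrank (ZMod 2) V) : ∃ x ∈ S, x ≠ 0 := by
  by_contra! h0
  have : Nontrivial V := Module.finrank_pos_iff.1 hV
  obtain ⟨v, hv⟩ := exists_ne (0 : V)
  obtain ⟨φ, hφ⟩ : ∃ φ : Dual (ZMod 2) V, φ v ≠ 0 := by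
    by_contra! H
    exact hv ((Module.forall_dual_apply_eq_zero_iff (ZMod 2) v).1 H)
  have h1 : wt S φ = 0 := by
    rw [wt, Multiset.sum_eq_zero]
    intro n hn
    obtain ⟨x, hx, rfl⟩ := Multiset.mem_map.1 hn
    simp [h0 x hx]
  have := h φ (by rintro rfl; simp at hφ)
  omega

/-- Forgetting the first coordinate. -/
abbrev tail (k : ℕ) : (Fin (k + 1) → ZMod 2) →ₗ[ZMod 2] (Fin k → ZMod 2) :=
  LinearMap.funLeft (ZMod 2) (ZMod 2) Fin.succ

theorem vecCons_tail {k : ℕ} (v : Fin (k + 1) → ZMod 2) :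
    Matrix.vecCons (v 0) (tail k v) = v := by
  ext i
  refine Fin.cases ?_ (fun i => ?_) i <;> simp [LinearMap.funLeft_apply]

theorem tail_vecCons {k : ℕ} (b : ZMod 2) (u : Fin k → ZMod 2) :
    tail k (Matrix.vecCons b u) = u := by
  ext i
  simp [LinearMap.funLeft_apply]

/-- Coordinates in which a heaviest nonzero column is the first unit vector, the projection from
that column is a prescribed multiset, and the lifts of the unit vectors are normalised. -/
theorem exists_coordinates {k : ℕ} [Module.Finite (ZMod 2) V] (hV : finrank (ZMod 2) V = k + 1)
    [DecidableEq V] {S : Multiset V} {x : V} (hx0 : x ≠ 0) {T : Multiset (Fin k → ZMod 2)}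
    (L : (V ⧸ (ZMod 2) ∙ x) →ₗ[ZMod 2] (Fin k → ZMod 2)) (hL : Function.Bijective L)
    (hT : (S.map (Submodule.mkQ ((ZMod 2) ∙ x))).map L = T) :
    ∃ B : V →ₗ[ZMod 2] (Fin (k + 1) → ZMod 2), Function.Bijective B ∧ B x = Matrix.vecCons 1 0 ∧
      (S.map B).map (tail k) = T ∧
      ∀ i : Fin k, (S.map B).count (Matrix.vecCons 1 (Pi.single i 1)) ≤
        (S.map B).count (Matrix.vecCons 0 (Pi.single i 1)) := by
  classical
  obtain ⟨φ, hφ⟩ : ∃ φ : Dual (ZMod 2) V, φ x = 1 := by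
    by_contra! H
    refine hx0 ((Module.forall_dual_apply_eq_zero_iff (ZMod 2) x).1 fun φ => ?_)
    have := H φ
    revert this
    generalize φ x = a
    revert a; decide
  let Q : V →ₗ[ZMod 2] (Fin k → ZMod 2) := L ∘ₗ Submodule.mkQ _
  have hQ : ∀ y, Q y = 0 → y = 0 ∨ y = x := by
    intro y hy
    have : (Submodule.mkQ ((ZMod 2) ∙ x)) y = 0 := hL.1 (by simpa [Q] using hy)
    rw [Submodule.mkQ_apply, Submodule.Quotient.mk_eq_zero, Submodule.mem_span_singleton] at this
    obtain ⟨a, rfl⟩ := this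
    have ha : ∀ b : ZMod 2, b = 0 ∨ b = 1 := by decide
    rcases ha a with rfl | rfl <;> simp
  have hQx : Q x = 0 := by
    have : (Submodule.mkQ ((ZMod 2) ∙ x)) x = 0 := by simp [Submodule.mem_span_singleton_self]
    simp only [Q, LinearMap.comp_apply, this, map_zero]
  let B (g : Dual (ZMod 2) (Fin k → ZMod 2)) : V →ₗ[ZMod 2] (Fin (k + 1) → ZMod 2) :=
    LinearMap.pi (Matrix.vecCons (φ + g ∘ₗ Q) fun i => LinearMap.proj i ∘ₗ Q)
  have hB : ∀ g y, B g y = Matrix.vecCons (φ y + g (Q y)) (Q y) := by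
    intro g y
    ext i
    refine Fin.cases ?_ (fun i => ?_) i <;> simp [B]
  obtain ⟨g, hg⟩ : ∃ g : Dual (ZMod 2) (Fin k → ZMod 2), ∀ i, g (Pi.single i 1) =
      if (S.map (B 0)).count (Matrix.vecCons 1 (Pi.single i 1)) ≤
        (S.map (B 0)).count (Matrix.vecCons 0 (Pi.single i 1)) then (0 : ZMod 2) else 1 := by
    refine ⟨(Pi.basisFun (ZMod 2) (Fin k)).constr (ZMod 2) fun i =>
      if (S.map (B 0)).count (Matrix.vecCons 1 (Pi.single i 1)) ≤
        (S.map (B 0)).count (Matrix.vecCons 0 (Pi.single i 1)) then (0 : ZMod 2) else 1,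
      fun i => ?_⟩
    rw [← Pi.basisFun_apply, Module.Basis.constr_basis]
    simp only [Pi.basisFun_apply]
  have hcount : ∀ b i, (S.map (B g)).count (Matrix.vecCons b (Pi.single i 1)) =
      (S.map (B 0)).count (Matrix.vecCons (b + g (Pi.single i 1)) (Pi.single i 1)) := by
    intro b i
    rw [Multiset.count_map, Multiset.count_map]
    congr 1
    refine Multiset.filter_congr fun y _ => ?_
    rw [hB, hB, Matrix.vecCons_inj, Matrix.vecCons_inj]
    refine and_congr_left fun h => ?_
    rw [← h, LinearMap.zero_apply, add_zero]
    generalize φ y = p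
    generalize g _ = q
    revert b p q; decide
  have hinj : Function.Injective (B g) := by
    rw [injective_iff_map_eq_zero]
    intro y hy
    rw [hB] at hy
    have h1 : Q y = 0 := by
      ext i
      simpa using congrFun hy i.succ
    have h2 : φ y = 0 := by
      have := congrFun hy 0
      simpa [h1] using this
    rcases hQ y h1 with h | rfl
    · exact h
    · rw [hφ] at h2
      exact absurd h2 (by decide)
  refine ⟨B g, ⟨hinj, (LinearMap.injective_iff_surjective_of_finrank_eq_finrank
    (by simp [hV])).1 hinj⟩, ?_, ?_, ?_⟩
  · rw [hB, hQx, hφ]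
    simp
  · rw [← hT, Multiset.map_map, Multiset.map_map]
    refine Multiset.map_congr rfl fun y _ => ?_
    rw [Function.comp_apply, hB, tail_vecCons]
    rfl
  · intro i
    rw [hcount, hcount, hg]
    split_ifs with h
    · simpa using h
    · rw [show (1 : ZMod 2) + 1 = 0 from rfl, zero_add]
      exact (not_le.1 h).le

variable {Z : Type*} [Fintype Z] [DecidableEq Z]

/-- The indicator function of a word. -/
noncomputable def indicator (Z : Type*) [Fintype Z] [DecidableEq Z] : PowSet Z ≃ₗ[ZMod 2] (Z → ZMod 2) :=
  LinearEquiv.ofBijective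
    (AddMonoidHom.toZModLinearMap 2
      (AddMonoidHom.mk' (fun A z => if z ∈ ofBoolRing A then 1 else 0) fun A B => by
        ext z
        rw [ofBoolRing_add]
        simp only [Finset.mem_symmDiff, Pi.add_apply]
        by_cases h1 : z ∈ ofBoolRing A <;> by_cases h2 : z ∈ ofBoolRing B <;> simp [h1, h2]
        rfl))
    ⟨fun A B h => by
      apply ofBoolRing.injective
      ext z
      have := congrFun h z
      by_cases h1 : z ∈ ofBoolRing A <;> by_cases h2 : z ∈ ofBoolRing B <;> simp_all,
    fun f => ⟨toBoolRing (Finset.univ.filter fun z => f z = 1), by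
      ext z
      have h : ∀ a : ZMod 2, (if a = 1 then (1 : ZMod 2) else 0) = a := by decide
      change (if z ∈ Finset.univ.filter (fun z => f z = 1) then (1 : ZMod 2) else 0) = f z
      rw [← h (f z)]
      simp⟩⟩

instance : FiniteDimensional (ZMod 2) (PowSet Z) := Module.Finite.equiv (indicator Z).symm

theorem indicator_apply (A : PowSet Z) (z : Z) :
    indicator Z A z = if z ∈ ofBoolRing A then 1 else 0 := rfl

theorem card_eq_sum_indicator (A : PowSet Z) :
    (ofBoolRing A).card = ∑ z, (indicator Z A z).val := by
  rw [Finset.card_eq_sum_ones, ← Finset.sum_filter_add_sum_filter_not Finset.univ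
    (fun z => z ∈ ofBoolRing A)]
  simp +contextual [indicator_apply, ZMod.val_one]

theorem indicator_full (z : Z) : indicator Z (toBoolRing (Finset.univ : Finset Z)) z = 1 := by
  simp [indicator_apply]

theorem indicator_permWord (τ : Equiv.Perm Z) (A : PowSet Z) (z : Z) :
    indicator Z (Code.permWord τ A) z = indicator Z A (τ⁻¹ z) := by
  simp only [indicator_apply, Code.permWord]
  congr 1
  simp only [ofBoolRing_toBoolRing, Finset.mem_map_equiv, eq_iff_iff]
  rfl

/-- The word of a functional plus a constant. -/
def wordMap (M : Z → V) : Dual (ZMod 2) V × ZMod 2 →ₗ[ZMod 2] (Z → ZMod 2) where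
  toFun p z := p.1 (M z) + p.2
  map_add' p q := by ext z; simp only [Prod.fst_add, Prod.snd_add, LinearMap.add_apply, Pi.add_apply]; ring
  map_smul' c p := by ext z; simp [mul_add]

/-- The code spanned by the full word and the rows of the matrix with columns `M`. -/
noncomputable def code (M : Z → V) : Code Z := (LinearMap.range (wordMap M)).map (indicator Z).symm.toLinearMap

theorem mem_code {M : Z → V} {A : PowSet Z} :
    A ∈ code M ↔ ∃ (φ : Dual (ZMod 2) V) (e : ZMod 2), ∀ z, indicator Z A z = φ (M z) + e := by
  simp only [code, Submodule.mem_map, LinearMap.mem_range, Prod.exists]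
  constructor
  · rintro ⟨_, ⟨φ, e, rfl⟩, rfl⟩
    exact ⟨φ, e, fun z => by simp [wordMap]⟩
  · rintro ⟨φ, e, h⟩
    exact ⟨_, ⟨φ, e, rfl⟩, (LinearEquiv.symm_apply_eq _).2 (funext fun z => (h z).symm)⟩

/-- The multiset of columns. -/
def columns (M : Z → V) : Multiset V := Finset.univ.val.map M

omit [DecidableEq Z] in
theorem wt_columns (M : Z → V) (φ : Dual (ZMod 2) V) : wt (columns M) φ = ∑ z, (φ (M z)).val := by
  rw [wt, columns, Multiset.map_map]
  rfl

omit [DecidableEq Z] in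
theorem sum_val_add_one (hZ : Fintype.card Z = 21) (f : Z → ZMod 2) :
    ∑ z, (f z + 1).val + ∑ z, (f z).val = 21 := by
  have h : ∀ a : ZMod 2, (a + 1).val + a.val = 1 := by decide
  simp [← Finset.sum_add_distrib, h, hZ]

theorem containsFull_code (M : Z → V) : Code.ContainsFull (code M) :=
  mem_code.2 ⟨0, 1, fun z => by simp [indicator_full]⟩

theorem zmod_two_cases (e : ZMod 2) : e = 0 ∨ e = 1 := by
  revert e; decide

theorem weightsAllowed_code (hZ : Fintype.card Z = 21) {M : Z → V} (h : Admissible (columns M)) :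
    Code.WeightsAllowed (code M) := by
  intro A hA
  obtain ⟨φ, e, hφ⟩ := mem_code.1 hA
  have hw := wt_columns M φ
  have h21 := sum_val_add_one hZ fun z => φ (M z)
  have hφ0 : wt (columns M) φ = 0 ∨ wt (columns M) φ = 8 ∨ wt (columns M) φ = 12 ∨
      wt (columns M) φ = 16 := by
    by_cases h0 : φ = 0
    · left; rw [h0, wt_zero]
    · right; exact h φ h0
  rw [card_eq_sum_indicator]
  simp only [hφ]
  rw [← hw] at h21
  rcases zmod_two_cases e with rfl | rfl
  · simp only [add_zero, ← hw]
    rcases hφ0 with h | h | h | h <;> rw [h] <;> decide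
  · have : ∑ z, (φ (M z) + 1).val = 21 - wt (columns M) φ := by omega
    rw [this]
    rcases hφ0 with h | h | h | h <;> rw [h] <;> decide

theorem finrank_code [Module.Finite (ZMod 2) V] (hZ : Fintype.card Z = 21) {M : Z → V}
    (h : Admissible (columns M)) : finrank (ZMod 2) (code M) = finrank (ZMod 2) V + 1 := by
  rw [code, LinearEquiv.finrank_map_eq, LinearMap.finrank_range_of_inj]
  · simp [Subspace.dual_finrank_eq]
  · rw [injective_iff_map_eq_zero]
    rintro ⟨φ, e⟩ h0
    have hz : ∀ z, φ (M z) + e = 0 := fun z => congrFun h0 z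
    have h21 := sum_val_add_one hZ fun z => φ (M z)
    rw [← wt_columns] at h21
    have hlt := h φ
    rcases zmod_two_cases e with rfl | rfl
    · have hw : wt (columns M) φ = 0 := by
        rw [wt_columns]
        exact Finset.sum_eq_zero fun z _ => by simpa using hz z
      by_cases h0 : φ = 0
      · rw [h0]; rfl
      · rcases hlt h0 with h | h | h <;> rw [hw] at h <;> simp at h
    · exfalso
      have h1 : ∑ z, (φ (M z) + 1).val = 0 := Finset.sum_eq_zero fun z _ => by simp [hz z]
      by_cases h0 : φ = 0
      · have hw : wt (columns M) φ = 0 := by rw [h0, wt_zero]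
        omega
      · have := hlt h0
        omega

theorem exists_eq_code {k : ℕ} (hZ : Fintype.card Z = 21) {C : Code Z}
    (hd : finrank (ZMod 2) C = k + 1) (hf : Code.ContainsFull C) (hw : Code.WeightsAllowed C) :
    ∃ M : Z → Fin k → ZMod 2, Admissible (columns M) ∧ code M = C := by
  classical
  let s : PowSet Z →ₗ[ZMod 2] ZMod 2 :=
    (∑ z, LinearMap.proj z : (Z → ZMod 2) →ₗ[ZMod 2] ZMod 2) ∘ₗ (indicator Z).toLinearMap
  have hs : ∀ A, s A = ((ofBoolRing A).card : ZMod 2) := by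
    intro A
    simp [s, card_eq_sum_indicator]
  let K := LinearMap.ker (s.domRestrict C)
  have hK : finrank (ZMod 2) K = k := by
    have h1 := LinearMap.finrank_range_add_finrank_ker (s.domRestrict C)
    have h2 : LinearMap.range (s.domRestrict C) = ⊤ := by
      rw [LinearMap.range_eq_top]
      intro a
      refine ⟨a • ⟨_, hf⟩, ?_⟩
      rw [map_smul, LinearMap.domRestrict_apply, hs]
      simp only [ofBoolRing_toBoolRing, Finset.card_univ, hZ, smul_eq_mul]
      revert a; decide
    rw [h2, finrank_top, finrank_self, hd] at h1
    change 1 + finrank (ZMod 2) K = k + 1 at h1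
    omega
  let M0 : Z → Dual (ZMod 2) K := fun z =>
    LinearMap.proj z ∘ₗ (indicator Z).toLinearMap ∘ₗ C.subtype ∘ₗ K.subtype
  have hM0 : ∀ z c, M0 z c = indicator Z (c : C) z := fun z c => rfl
  let E : Dual (ZMod 2) K ≃ₗ[ZMod 2] (Fin k → ZMod 2) :=
    LinearEquiv.ofFinrankEq _ _ (by simp [Subspace.dual_finrank_eq, hK])
  have heval : ∀ φ : Dual (ZMod 2) (Fin k → ZMod 2), ∃ c : K, (c = 0 → φ = 0) ∧
      ∀ z, φ (E (M0 z)) = indicator Z (c : C) z := by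
    intro φ
    refine ⟨(evalEquiv (ZMod 2) K).symm (φ ∘ₗ E.toLinearMap), fun h => ?_, fun z => ?_⟩
    · rw [LinearEquiv.map_eq_zero_iff] at h
      refine LinearMap.ext fun x => ?_
      simpa using LinearMap.congr_fun h (E.symm x)
    · rw [← hM0, Module.apply_evalEquiv_symm_apply]
      rfl
  refine ⟨fun z => E (M0 z), ?_, ?_⟩
  · intro φ hφ
    obtain ⟨c, hc0, hc⟩ := heval φ
    have hwt : wt (columns fun z => E (M0 z)) φ = (ofBoolRing ((c : C) : PowSet Z)).card := by
      rw [wt_columns, card_eq_sum_indicator]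
      simp only [hc]
    have hev : ((ofBoolRing ((c : C) : PowSet Z)).card : ZMod 2) = 0 := by
      rw [← hs]
      exact c.2
    have hev' : 2 ∣ (ofBoolRing ((c : C) : PowSet Z)).card := (ZMod.natCast_eq_zero_iff _ _).1 hev
    have h0 : (ofBoolRing ((c : C) : PowSet Z)).card ≠ 0 := by
      intro h0
      rw [Finset.card_eq_zero] at h0
      refine hφ (hc0 (Subtype.ext (Subtype.ext (ofBoolRing.injective ?_))))
      simpa using h0
    have := hw _ (c : C).2
    rw [hwt]
    simp only [Finset.mem_insert, Finset.mem_singleton] at this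
    omega
  · ext A
    rw [mem_code]
    constructor
    · rintro ⟨φ, e, h⟩
      obtain ⟨c, -, hc⟩ := heval φ
      have : A = (c : C) + e • toBoolRing (Finset.univ : Finset Z) := by
        apply (indicator Z).injective
        ext z
        rw [h, hc, map_add, map_smul]
        simp [indicator_full]
      rw [this]
      exact C.add_mem (c : C).2 (C.smul_mem _ hf)
    · intro hA
      have hmem : (⟨A, hA⟩ : C) + s A • ⟨_, hf⟩ ∈ K := by
        rw [LinearMap.mem_ker, map_add, map_smul, LinearMap.domRestrict_apply,
          LinearMap.domRestrict_apply, hs (toBoolRing Finset.univ)]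
        simp only [ofBoolRing_toBoolRing, Finset.card_univ, hZ, smul_eq_mul]
        generalize s A = a
        revert a; decide
      refine ⟨Dual.eval (ZMod 2) K ⟨_, hmem⟩ ∘ₗ E.symm.toLinearMap, s A, fun z => ?_⟩
      simp only [LinearMap.comp_apply, LinearEquiv.coe_coe, LinearEquiv.symm_apply_apply,
        Dual.eval_apply, hM0]
      simp only [Submodule.coe_add, Submodule.coe_smul, map_add, map_smul, Pi.add_apply,
        Pi.smul_apply, indicator_full, smul_eq_mul, mul_one]
      generalize s A = a
      generalize indicator Z A z = b
      revert a b; decide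

omit [DecidableEq Z] [AddCommGroup V] [Module (ZMod 2) V] [AddCommGroup W]
  [Module (ZMod 2) W] in
theorem columns_comp (L : V → W) (M : Z → V) : columns (fun z => L (M z)) = (columns M).map L := by
  simp [columns, Multiset.map_map]

omit [DecidableEq Z] [AddCommGroup V] [Module (ZMod 2) V] in
theorem columns_comp_perm (M : Z → V) (τ : Equiv.Perm Z) : columns (fun z => M (τ z)) = columns M := by
  have h : (Finset.univ : Finset Z).val.map τ = Finset.univ.val :=
    congrArg Finset.val (Finset.map_univ_equiv τ)
  conv_rhs => rw [columns, ← h, Multiset.map_map]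
  rfl

omit [DecidableEq Z] [AddCommGroup V] [Module (ZMod 2) V] in
theorem exists_columns_eq (hZ : Fintype.card Z = 21) {S : Multiset V} (hS : S.card = 21) :
    ∃ M : Z → V, columns M = S := by
  obtain ⟨l, rfl⟩ := Quot.exists_rep S
  have hl : l.length = 21 := hS
  let e : Z ≃ Fin l.length := Fintype.equivOfCardEq (by simp [hZ, hl])
  refine ⟨fun z => l.get (e z), ?_⟩
  have h : (Finset.univ : Finset Z).val.map e = Finset.univ.val :=
    congrArg Finset.val (Finset.map_univ_equiv e)
  have h2 : (Finset.univ : Finset (Fin l.length)).val.map l.get = (l : Multiset V) := by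
    rw [Fin.univ_val_map, List.ofFn_get]
  change (Finset.univ : Finset Z).val.map (l.get ∘ e) = l
  rw [← Multiset.map_map, h, h2]

omit [DecidableEq Z] [AddCommGroup V] [Module (ZMod 2) V] in
theorem exists_perm_of_columns_eq {M M' : Z → V} (h : columns M = columns M') :
    ∃ τ : Equiv.Perm Z, ∀ z, M (τ z) = M' z := by
  classical
  have hc : ∀ v, Fintype.card {z // M z = v} = Fintype.card {z // M' z = v} := by
    intro v
    have := congrArg (Multiset.count v) h
    rw [columns, columns, Multiset.count_map, Multiset.count_map] at this
    rw [Fintype.card_subtype, Fintype.card_subtype, Finset.card_def, Finset.card_def]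
    simpa [eq_comm] using this
  refine ⟨(Equiv.sigmaFiberEquiv M').symm.trans ((Equiv.sigmaCongrRight fun v =>
    Fintype.equivOfCardEq (hc v).symm).trans (Equiv.sigmaFiberEquiv M)), fun z => ?_⟩
  exact (Fintype.equivOfCardEq (hc (M' z)).symm ⟨z, rfl⟩).2

/-- Codes with equivalent columns are equivalent. -/
theorem permEquiv_code {M : Z → V} {M' : Z → W} (L : V →ₗ[ZMod 2] W) (hL : Function.Bijective L)
    (h : (columns M).map L = columns M') : Code.PermEquiv (code M) (code M') := by
  rw [← columns_comp] at h
  obtain ⟨τ, hτ⟩ := exists_perm_of_columns_eq h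
  let E := LinearEquiv.ofBijective L hL
  refine ⟨τ⁻¹, Set.ext fun A => ?_⟩
  simp only [Set.mem_image, SetLike.mem_coe]
  constructor
  · rintro ⟨A, hA, rfl⟩
    obtain ⟨φ, e, hφ⟩ := mem_code.1 hA
    refine mem_code.2 ⟨φ ∘ₗ E.symm.toLinearMap, e, fun z => ?_⟩
    rw [indicator_permWord, inv_inv, hφ, ← hτ]
    simp only [LinearMap.comp_apply, LinearEquiv.coe_coe]
    rw [show L (M (τ z)) = E (M (τ z)) from rfl, E.symm_apply_apply]
  · intro hA
    obtain ⟨φ, e, hφ⟩ := mem_code.1 hA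
    refine ⟨Code.permWord τ A, mem_code.2 ⟨φ ∘ₗ L, e, fun z => ?_⟩, ?_⟩
    · rw [indicator_permWord, hφ, ← hτ]
      simp
    · rw [← Code.permWord_mul, inv_mul_cancel, Code.permWord_one]

/-- Equivalent codes have equivalent columns. -/
theorem exists_linearMap_of_permEquiv {k : ℕ} (hZ : Fintype.card Z = 21) {M : Z → V}
    {M' : Z → Fin k → ZMod 2} (hM : Admissible (columns M)) (hM' : Admissible (columns M'))
    (h : Code.PermEquiv (code M) (code M')) :
    ∃ L : V →ₗ[ZMod 2] (Fin k → ZMod 2), (columns M).map L = columns M' := by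
  obtain ⟨τ, hτ⟩ := h
  have key : ∀ i : Fin k, ∃ ψ : Dual (ZMod 2) V, ∀ z, M' z i = ψ (M (τ⁻¹ z)) := by
    intro i
    let φ : Dual (ZMod 2) (Fin k → ZMod 2) := LinearMap.proj i
    have hmem : (indicator Z).symm (fun z => φ (M' z)) ∈ (code M' : Set (PowSet Z)) :=
      mem_code.2 ⟨φ, 0, fun z => by simp⟩
    rw [← hτ] at hmem
    obtain ⟨A, hA, hA'⟩ := hmem
    obtain ⟨ψ, e, hψ⟩ := mem_code.1 hA
    have heq : ∀ z, φ (M' z) = ψ (M (τ⁻¹ z)) + e := by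
      intro z
      rw [← hψ, ← indicator_permWord, hA']
      simp
    rcases zmod_two_cases e with rfl | rfl
    · exact ⟨ψ, fun z => (heq z).trans (add_zero _)⟩
    · exfalso
      have h1 := sum_val_add_one hZ fun z => ψ (M (τ⁻¹ z))
      simp only [← heq] at h1
      rw [← wt_columns, ← wt_columns (fun z => M (τ⁻¹ z)), columns_comp_perm] at h1
      have := hM.four_dvd ψ
      have := hM'.four_dvd φ
      omega
  choose ψ hψ using key
  refine ⟨LinearMap.pi ψ, ?_⟩
  rw [← columns_comp_perm M τ⁻¹, ← columns_comp]
  congr 1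
  ext z i
  simp [hψ]

/-- The number of classes of codes is the length of a list of column multisets that represents
every admissible multiset exactly once up to linear maps. -/
theorem r_eq_length {k σ : ℕ} (hZ : Fintype.card Z = 21) (hk : k + 1 + σ = 11)
    (l : List (Multiset (Fin k → ZMod 2)))
    (hl : ∀ S ∈ l, S.card = 21 ∧ Admissible S)
    (hex : ∀ S : Multiset (Fin k → ZMod 2), S.card = 21 → Admissible S →
      ∃ T ∈ l, ∃ L : (Fin k → ZMod 2) →ₗ[ZMod 2] (Fin k → ZMod 2), S.map L = T)
    (hne : l.Pairwise fun S T =>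
      ¬∃ L : (Fin k → ZMod 2) →ₗ[ZMod 2] (Fin k → ZMod 2), S.map L = T) :
    Code.r Z σ = l.length := by
  have hM : ∀ i : Fin l.length, ∃ M : Z → Fin k → ZMod 2, columns M = l.get i := fun i =>
    exists_columns_eq hZ (hl _ (l.get_mem i)).1
  choose M hM using hM
  have hadm : ∀ i, Admissible (columns (M i)) := fun i => by
    rw [hM]; exact (hl _ (l.get_mem i)).2
  let F : Fin l.length → Quotient (Code.permSetoid Z) := fun i => Quotient.mk _ (code (M i))
  have hF : Function.Injective F := by
    have hlt : ∀ i j, i < j → F i ≠ F j := by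
      intro i j hij h
      have := List.pairwise_iff_get.1 hne i j hij
      rw [← hM, ← hM] at this
      exact this (exists_linearMap_of_permEquiv hZ (hadm i) (hadm j) (Quotient.exact h))
    intro i j h
    rcases lt_trichotomy i j with hij | hij | hij
    · exact absurd h (hlt i j hij)
    · exact hij
    · exact absurd h.symm (hlt j i hij)
  have hset : {c : Quotient (Code.permSetoid Z) | ∃ C : Code Z,
      Quotient.mk (Code.permSetoid Z) C = c ∧ finrank (ZMod 2) C + σ = 11 ∧
        Code.ContainsFull C ∧ Code.WeightsAllowed C} = Set.range F := by
    ext c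
    constructor
    · rintro ⟨C, rfl, hd, hf, hw⟩
      obtain ⟨N, hN, rfl⟩ := exists_eq_code (k := k) hZ (by omega) hf hw
      obtain ⟨T, hT, L, hLT⟩ := hex (columns N) (by simp [columns, hZ]) hN
      obtain ⟨i, rfl⟩ := List.get_of_mem hT
      refine ⟨i, Quotient.sound (Code.permSetoid Z |>.symm (permEquiv_code L ?_ ?_))⟩
      · refine Admissible.bijective (S := columns N) ?_ rfl
        rw [hLT]
        exact (hl _ hT).2
      · rw [hLT, hM]
    · rintro ⟨i, rfl⟩
      refine ⟨code (M i), rfl, ?_, containsFull_code _, weightsAllowed_code hZ (hadm i)⟩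
      rw [finrank_code hZ (hadm i)]
      simpa using hk
  rw [Code.r, hset, ← Set.image_univ, Set.ncard_image_of_injective _ hF, Set.ncard_univ,
    Nat.card_eq_fintype_card, Fintype.card_fin]

/-! ### Binary encoding of columns -/

/-- The column of length `k` whose entries are the binary digits of `c`. -/
def vec (k c : ℕ) : Fin k → ZMod 2 := fun i => ((c / 2 ^ (i : ℕ) : ℕ) : ZMod 2)

theorem cast_div_two_pow (c i : ℕ) :
    ((c / 2 ^ i : ℕ) : ZMod 2) = if c.testBit i then 1 else 0 := by
  rw [Nat.testBit_eq_decide_div_mod_eq]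
  rcases Nat.mod_two_eq_zero_or_one (c / 2 ^ i) with h | h
  · simp [h, (ZMod.natCast_eq_zero_iff_even).2 (Nat.even_iff.2 h)]
  · simp [h, (ZMod.natCast_eq_one_iff_odd).2 (Nat.odd_iff.2 h)]

theorem vec_zero (k : ℕ) : vec k 0 = 0 := by
  ext i; simp [vec]

theorem vec_succ (k c : ℕ) : vec (k + 1) c = Matrix.vecCons (c : ZMod 2) (vec k (c / 2)) := by
  ext i
  refine Fin.cases ?_ (fun i => ?_) i
  · simp [vec]
  · simp [vec, pow_succ', Nat.div_div_eq_div_mul]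

theorem vec_two_mul (k c : ℕ) : vec (k + 1) (2 * c) = Matrix.vecCons 0 (vec k c) := by
  rw [vec_succ, Nat.mul_div_cancel_left _ two_pos]
  congr 1
  rw [Nat.cast_mul, show ((2 : ℕ) : ZMod 2) = 0 from rfl, zero_mul]

theorem vec_two_mul_add_one (k c : ℕ) :
    vec (k + 1) (2 * c + 1) = Matrix.vecCons 1 (vec k c) := by
  rw [vec_succ, show (2 * c + 1) / 2 = c by omega]
  congr 1
  rw [Nat.cast_add, Nat.cast_mul, show ((2 : ℕ) : ZMod 2) = 0 from rfl, zero_mul, zero_add,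
    Nat.cast_one]

theorem vec_xor (k a b : ℕ) : vec k (Nat.xor a b) = vec k a + vec k b := by
  ext i
  simp only [vec, cast_div_two_pow, Pi.add_apply]
  rw [show Nat.xor a b = a ^^^ b from rfl, Nat.testBit_xor]
  cases a.testBit i <;> cases b.testBit i <;> rfl

theorem vec_land (k a b : ℕ) : vec k (Nat.land a b) = vec k a * vec k b := by
  ext i
  simp only [vec, cast_div_two_pow, Pi.mul_apply]
  rw [show Nat.land a b = a &&& b from rfl, Nat.testBit_and]
  cases a.testBit i <;> cases b.testBit i <;> rfl

theorem vec_two_pow {k : ℕ} (i : Fin k) : vec k (2 ^ (i : ℕ)) = Pi.single i 1 := by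
  ext j
  rw [vec, cast_div_two_pow, Nat.testBit_two_pow, Pi.single_apply]
  by_cases h : i = j
  · simp [h]
  · simp [Fin.val_ne_of_ne h, Ne.symm h]

theorem vec_inj {k a b : ℕ} (ha : a < 2 ^ k) (hb : b < 2 ^ k) (h : vec k a = vec k b) : a = b := by
  refine Nat.eq_of_testBit_eq fun i => ?_
  by_cases hi : i < k
  · have := congrFun h ⟨i, hi⟩
    simp only [vec, cast_div_two_pow] at this
    revert this
    cases a.testBit i <;> cases b.testBit i <;> simp
  · have hle : 2 ^ k ≤ 2 ^ i := Nat.pow_le_pow_right two_pos (not_lt.1 hi)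
    rw [Nat.testBit_lt_two_pow (ha.trans_le hle), Nat.testBit_lt_two_pow (hb.trans_le hle)]

/-- The sum of the binary digits of `x` modulo `2`. -/
def parity : ℕ → ℕ → ℕ
  | 0, _ => 0
  | k + 1, x => (x + parity k (x / 2)) % 2

theorem parity_lt (k x : ℕ) : parity k x < 2 := by
  cases k with
  | zero => exact two_pos
  | succ k => exact Nat.mod_lt _ two_pos

theorem cast_parity (k x : ℕ) : (parity k x : ZMod 2) = ∑ i, vec k x i := by
  induction k generalizing x with
  | zero => simp [parity]
  | succ k ih => rw [parity, ZMod.natCast_mod, vec_succ, Fin.sum_univ_succ]; simp [ih]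

theorem cast_parity_land (k x y : ℕ) : (parity k (Nat.land x y) : ZMod 2) = vec k x ⬝ᵥ vec k y := by
  rw [cast_parity, vec_land]; rfl

theorem parity_eq_zero_iff {k x y : ℕ} : parity k (Nat.land x y) = 0 ↔ vec k x ⬝ᵥ vec k y = 0 := by
  rw [← cast_parity_land, ZMod.natCast_eq_zero_iff]
  have := parity_lt k (Nat.land x y)
  omega

/-- All vectors of length `k`. -/
def vectors : (k : ℕ) → List (Fin k → ZMod 2)
  | 0 => [0]
  | k + 1 => (vectors k).map (Matrix.vecCons 0) ++ (vectors k).map (Matrix.vecCons 1)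

theorem mem_vectors {k : ℕ} (v : Fin k → ZMod 2) : v ∈ vectors k := by
  induction k with
  | zero => simp [vectors, Subsingleton.elim v 0]
  | succ k ih =>
    rw [← vecCons_tail v]
    simp only [vectors, List.mem_append, List.mem_map]
    rcases zmod_two_cases (v 0) with h | h <;> rw [h]
    · exact Or.inl ⟨_, ih _, rfl⟩
    · exact Or.inr ⟨_, ih _, rfl⟩

theorem nodup_vectors (k : ℕ) : (vectors k).Nodup := by
  induction k with
  | zero => simp [vectors]
  | succ k ih =>
    have hinj : ∀ b : ZMod 2, Function.Injective (Matrix.vecCons b : (Fin k → ZMod 2) → _) :=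
      fun b u v h => (Matrix.vecCons_inj.1 h).2
    refine List.Nodup.append (ih.map (hinj 0)) (ih.map (hinj 1)) ?_
    intro v h0 h1
    obtain ⟨u, -, rfl⟩ := List.mem_map.1 h0
    obtain ⟨w, -, h⟩ := List.mem_map.1 h1
    exact absurd (Matrix.vecCons_inj.1 h).1 (by decide)

theorem sum_vectors {k : ℕ} (g : (Fin k → ZMod 2) → ℕ) : ((vectors k).map g).sum = ∑ f, g f := by
  rw [← List.sum_toFinset g (nodup_vectors k)]
  refine Finset.sum_congr (Finset.eq_univ_of_forall fun f => ?_) fun _ _ => rfl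
  simpa using mem_vectors f

theorem vectors_eq_cons (k : ℕ) : ∃ l, vectors k = 0 :: l := by
  induction k with
  | zero => exact ⟨[], rfl⟩
  | succ k ih =>
    obtain ⟨l, hl⟩ := ih
    rw [vectors, hl, List.map_cons, List.cons_append]
    refine ⟨_, congrArg (· :: _) ?_⟩
    ext i
    refine Fin.cases ?_ (fun i => ?_) i <;> simp

/-- The values of all functionals on the column encoded by `y`. -/
def dots : ℕ → ℕ → List ℕ
  | 0, _ => [0]
  | k + 1, y =>
    dots k (y / 2) ++
      bif Nat.beq (y % 2) 0 then dots k (y / 2) else (dots k (y / 2)).map fun a => 1 - a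

theorem val_one_add (a : ZMod 2) : (1 + a).val = 1 - a.val := by
  revert a; decide

theorem dots_eq (k y : ℕ) : dots k y = (vectors k).map fun f => (f ⬝ᵥ vec k y).val := by
  induction k generalizing y with
  | zero => simp [dots, vectors]
  | succ k ih =>
    rw [dots, vectors, List.map_append, List.map_map, List.map_map, ih, vec_succ]
    congr 1
    · simp [Function.comp_def]
    · rcases Nat.mod_two_eq_zero_or_one y with h | h
      · simp [h, (ZMod.natCast_eq_zero_iff_even).2 (Nat.even_iff.2 h), Function.comp_def]
      · simp [h, (ZMod.natCast_eq_one_iff_odd).2 (Nat.odd_iff.2 h), Function.comp_def, val_one_add,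
          show Nat.beq 1 0 = false from rfl]

/-! ### Packed lists of weights -/

/-- A list of numbers below `256` packed into a single number. -/
def pack (l : List ℕ) : ℕ := l.foldr (fun a r => a + 256 * r) 0

theorem pack_cons (a : ℕ) (l : List ℕ) : pack (a :: l) = a + 256 * pack l := rfl

theorem pack_map_add {α : Type*} (l : List α) (f g : α → ℕ) :
    pack (l.map f) + pack (l.map g) = pack (l.map fun x => f x + g x) := by
  induction l with
  | nil => rfl
  | cons a l ih => simp only [List.map_cons, pack_cons, ← ih]; ring

theorem mul_pack_map {α : Type*} (l : List α) (c : ℕ) (f : α → ℕ) :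
    c * pack (l.map f) = pack (l.map fun x => c * f x) := by
  induction l with
  | nil => rfl
  | cons a l ih => simp only [List.map_cons, pack_cons, ← ih]; ring

theorem land_add_mul {a b : ℕ} (ha : a < 256) (hb : b < 256) (x y : ℕ) :
    Nat.land (a + 256 * x) (b + 256 * y) = Nat.land a b + 256 * Nat.land x y := by
  have h : ∀ {c : ℕ} (_ : c < 256) (z : ℕ), (c + 256 * z) / 2 ^ 8 = z ∧ (c + 256 * z) % 2 ^ 8 = c :=
    fun _ _ => by omega
  have hab : a &&& b < 256 := lt_of_le_of_lt Nat.and_le_left ha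
  change (a + 256 * x) &&& (b + 256 * y) = (a &&& b) + 256 * (x &&& y)
  rw [← Nat.div_add_mod ((a + 256 * x) &&& (b + 256 * y)) (2 ^ 8), Nat.and_mod_two_pow,
    Nat.and_div_two_pow, (h ha x).1, (h ha x).2, (h hb y).1, (h hb y).2]
  ring

theorem land_pack {α : Type*} (l : List α) {f g : α → ℕ} (hf : ∀ x ∈ l, f x < 256)
    (hg : ∀ x ∈ l, g x < 256) :
    Nat.land (pack (l.map f)) (pack (l.map g)) = pack (l.map fun x => Nat.land (f x) (g x)) := by
  induction l with
  | nil => exact (by decide : Nat.land 0 0 = 0)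
  | cons a l ih =>
    simp only [List.mem_cons, forall_eq_or_imp] at hf hg
    simp only [List.map_cons, pack_cons, ← ih hf.2 hg.2, land_add_mul hf.1 hg.1]

/-- The packed list of `2 ^ k` ones. -/
def ones (k : ℕ) : ℕ := pack ((dots k 0).map fun _ => 1)

theorem mul_ones (k c : ℕ) : c * ones k = pack ((vectors k).map fun _ => c) := by
  rw [ones, dots_eq, List.map_map, mul_pack_map]
  simp

/-- A list of columns with multiplicities and test vectors. The zero column is left out. -/
abbrev Table := List (ℕ × ℕ × ℕ)

/-- The multiset given by a list of numbers with multiplicities. -/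
def expand (L : List (ℕ × ℕ)) : Multiset ℕ := (L.map fun p => Multiset.replicate p.2 p.1).sum

theorem expand_cons (p : ℕ × ℕ) (L : List (ℕ × ℕ)) :
    expand (p :: L) = Multiset.replicate p.2 p.1 + expand L := rfl

/-- The ways to split `m` copies of the column `y` into `m - t` copies of `(0, y)` and `t` copies
of `(1, y)` such that no multiplicity exceeds `j`, with their packed contributions to the weights
and to the parities. On unit vectors `t` is at most `m / 2`. -/
def splittings (k j y m : ℕ) : List (ℕ × ℕ × ℕ) :=
  ((List.range (m + 1)).filter fun t =>
    Nat.ble t j && Nat.ble (m - t) j &&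
      (!((List.range k).any fun i => Nat.beq (2 ^ i) y) || Nat.ble (2 * t) m)).map fun t =>
    (t, t * pack ((dots k y).map fun a => 1 - a) + (m - t) * pack (dots k y),
      bif Nat.beq (t % 2) 0 then 0 else y)

/-- A depth first search over the splittings of all columns. A branch is abandoned when one of the
packed weights exceeds `16` or a parity test fails. -/
def search (k o : ℕ) : List ((ℕ × ℕ × ℕ) × List (ℕ × ℕ × ℕ)) → ℕ → ℕ → List (ℕ × ℕ) →
    List (List (ℕ × ℕ)) → List (List (ℕ × ℕ))
  | [], w, _, acc, out =>
    bif Nat.beq (Nat.land w (3 * o)) 0 && Nat.beq (Nat.land (w + 111 * o) (128 * o)) 0 &&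
      Nat.beq (Nat.land (w + 120 * o) (128 * o)) (128 * o) then acc :: out else out
  | (i, c) :: rest, w, p, acc, out =>
    c.foldr (fun s out =>
      bif Nat.beq (parity k (Nat.land i.2.2 (Nat.xor p s.2.2))) 0 &&
          Nat.beq (Nat.land (w + s.2.1 + 111 * o) (128 * o)) 0 then
        search k o rest (w + s.2.1) (Nat.xor p s.2.2)
          ((2 * i.1, i.2.1 - s.1) :: (2 * i.1 + 1, s.1) :: acc) out
      else out) out

theorem subset_foldr {α β : Type*} {g : α → List β → List β} (hg : ∀ a l, l ⊆ g a l) (c : List α)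
    (l : List β) : l ⊆ c.foldr g l := by
  induction c with
  | nil => exact fun _ h => h
  | cons a c ih => exact fun _ h => hg _ _ (ih h)

theorem mem_foldr {α β : Type*} {g : α → List β → List β} (hg : ∀ a l, l ⊆ g a l) {c : List α}
    {a : α} (ha : a ∈ c) {b : β} (hb : ∀ l, b ∈ g a l) (l : List β) : b ∈ c.foldr g l := by
  induction c with
  | nil => simp at ha
  | cons a' c ih =>
    rw [List.foldr_cons]
    rcases List.mem_cons.1 ha with rfl | h
    · exact hb _
    · exact hg _ _ (ih h)

theorem subset_search (k o : ℕ) (I : List ((ℕ × ℕ × ℕ) × List (ℕ × ℕ × ℕ))) (w p : ℕ)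
    (acc : List (ℕ × ℕ)) (out : List (List (ℕ × ℕ))) : out ⊆ search k o I w p acc out := by
  induction I generalizing w p acc out with
  | nil =>
    rw [search, Bool.cond_eq_ite]
    split_ifs
    · exact fun _ h => List.mem_cons_of_mem _ h
    · exact fun _ h => h
  | cons i I ih =>
    rw [search]
    refine subset_foldr (fun s l => ?_) _ _
    rw [Bool.cond_eq_ite]
    split_ifs
    · exact ih _ _ _ _
    · exact fun _ h => h

/-- Every test vector is orthogonal to all later columns. -/
def wellTested (k : ℕ) : Table → Bool
  | [] => true
  | i :: R => (R.all fun i' => Nat.beq (parity k (Nat.land i.2.2 i'.1)) 0) && wellTested k R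

/-- The contribution to the weight of `(1, f)` of a column with multiplicity `m` that is split with
`t` lifts `(1, y)`, where `a` is the value of `f` on `y`. -/
def contribution (t m a : ℕ) : ℕ := t * (1 - a) + (m - t) * a

/-- The columns of the extension of `R` in which the column `y` has `T y` lifts `(1, y)`. -/
def lifts (T : ℕ → ℕ) (R : Table) : Multiset ℕ :=
  (R.map fun i => Multiset.replicate (i.2.1 - T i.1) (2 * i.1) +
    Multiset.replicate (T i.1) (2 * i.1 + 1)).sum

/-- Conditions under which `T y` is one of the splittings of `y`. -/
def SplittingBounds (k j : ℕ) (T : ℕ → ℕ) (R : Table) : Prop :=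
  ∀ i ∈ R, T i.1 ≤ i.2.1 ∧ T i.1 ≤ j ∧ i.2.1 - T i.1 ≤ j ∧
    ∀ n < k, 2 ^ n = i.1 → 2 * T i.1 ≤ i.2.1

theorem mem_splittings {k j y m t : ℕ} (h1 : t ≤ m) (h2 : t ≤ j) (h3 : m - t ≤ j)
    (h4 : ∀ n < k, 2 ^ n = y → 2 * t ≤ m) :
    (t, pack ((vectors k).map fun f => contribution t m (f ⬝ᵥ vec k y).val),
      bif Nat.beq (t % 2) 0 then 0 else y) ∈ splittings k j y m := by
  refine List.mem_map.2 ⟨t, List.mem_filter.2 ⟨List.mem_range.2 (by omega), ?_⟩, ?_⟩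
  · simp only [Bool.and_eq_true, Nat.ble_eq, Bool.or_eq_true, Bool.not_eq_true',
      List.any_eq_false, List.mem_range, Nat.beq_eq]
    refine ⟨⟨h2, h3⟩, ?_⟩
    by_cases h : 2 * t ≤ m
    · exact Or.inr h
    · exact Or.inl fun n hn he => h (h4 n hn he)
  · rw [dots_eq, List.map_map, mul_pack_map, mul_pack_map, pack_map_add]
    rfl

theorem vec_parity_choice (k t y : ℕ) :
    vec k (bif Nat.beq (t % 2) 0 then 0 else y) = (t : ZMod 2) • vec k y := by
  rcases Nat.mod_two_eq_zero_or_one t with h | h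
  · simp [h, (ZMod.natCast_eq_zero_iff_even).2 (Nat.even_iff.2 h), vec_zero]
  · simp [h, (ZMod.natCast_eq_one_iff_odd).2 (Nat.odd_iff.2 h), show Nat.beq 1 0 = false from rfl]

theorem land_eq_zero_of_lt : ∀ a < 128, Nat.land a 128 = 0 := by decide

theorem land_pack_add_eq_zero {k : ℕ} {g : (Fin k → ZMod 2) → ℕ} (hg : ∀ f, g f ≤ 16) :
    Nat.land (pack ((vectors k).map g) + 111 * ones k) (128 * ones k) = 0 := by
  have hlt : ∀ f, g f + 111 < 128 := fun f => by have := hg f; omega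
  rw [mul_ones, mul_ones, pack_map_add,
    land_pack _ (fun f _ => (hlt f).trans (by norm_num)) (fun _ _ => by norm_num)]
  have : ∀ f ∈ vectors k, Nat.land (g f + 111) 128 = 0 * 0 :=
    fun f _ => land_eq_zero_of_lt _ (hlt f)
  rw [List.map_congr_left this, ← mul_pack_map, zero_mul]

theorem exists_mem_search {k j : ℕ} {T : ℕ → ℕ} {R : Table} (hR : wellTested k R = true)
    (hT : SplittingBounds k j T R) (g : (Fin k → ZMod 2) → ℕ) (p : ℕ) (acc : List (ℕ × ℕ))
    (hg : ∀ f, g f + (R.map fun i => contribution (T i.1) i.2.1 (f ⬝ᵥ vec k i.1).val).sum = 8 ∨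
      g f + (R.map fun i => contribution (T i.1) i.2.1 (f ⬝ᵥ vec k i.1).val).sum = 12 ∨
      g f + (R.map fun i => contribution (T i.1) i.2.1 (f ⬝ᵥ vec k i.1).val).sum = 16)
    (hp : ∀ f, f ⬝ᵥ vec k p + (R.map fun i => (T i.1 : ZMod 2) * (f ⬝ᵥ vec k i.1)).sum = 0) :
    ∃ L, expand L = expand acc + lifts T R ∧
      ∀ out, L ∈ search k (ones k) (R.map fun i => (i, splittings k j i.1 i.2.1))
        (pack ((vectors k).map g)) p acc out := by
  induction R generalizing g p acc with
  | nil =>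
    refine ⟨acc, by simp [lifts], fun out => ?_⟩
    simp only [List.map_nil, List.sum_nil, add_zero] at hg
    rw [List.map_nil, search]
    have h1 : Nat.land (pack ((vectors k).map g)) (3 * ones k) = 0 := by
      rw [mul_ones, land_pack _ (fun f _ => by have := hg f; omega) (fun _ _ => by norm_num)]
      have : ∀ f ∈ vectors k, Nat.land (g f) 3 = 0 * 0 := fun f _ => by
        rcases hg f with h | h | h <;> rw [h] <;> rfl
      rw [List.map_congr_left this, ← mul_pack_map, zero_mul]
    have h2 : Nat.land (pack ((vectors k).map g) + 120 * ones k) (128 * ones k) =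
        128 * ones k := by
      rw [mul_ones, mul_ones, pack_map_add,
        land_pack _ (fun f _ => by have := hg f; omega) (fun _ _ => by norm_num)]
      refine congrArg pack (List.map_congr_left fun f _ => ?_)
      rcases hg f with h | h | h <;> rw [h] <;> rfl
    rw [h1, h2, land_pack_add_eq_zero fun f => by have := hg f; omega, Nat.beq_refl, Nat.beq_refl]
    exact List.mem_cons_self
  | cons i R ih =>
    obtain ⟨hi, hT'⟩ := List.forall_mem_cons.1 hT
    simp only [wellTested, Bool.and_eq_true, List.all_eq_true, Nat.beq_eq,
      parity_eq_zero_iff] at hR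
    simp only [List.map_cons, List.sum_cons] at hg hp
    set δ := bif Nat.beq (T i.1 % 2) 0 then 0 else i.1 with hδ
    have hvδ : vec k (Nat.xor p δ) = vec k p + (T i.1 : ZMod 2) • vec k i.1 := by
      rw [vec_xor, hδ, vec_parity_choice]
    obtain ⟨L, hL, hmem⟩ := ih hR.2 hT'
      (fun f => g f + contribution (T i.1) i.2.1 (f ⬝ᵥ vec k i.1).val) (Nat.xor p δ)
      ((2 * i.1, i.2.1 - T i.1) :: (2 * i.1 + 1, T i.1) :: acc)
      (fun f => by simpa only [add_assoc] using hg f)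
      (fun f => by
        rw [hvδ, dotProduct_add, dotProduct_smul, smul_eq_mul, add_assoc]
        exact hp f)
    refine ⟨L, ?_, fun out => ?_⟩
    · rw [hL, expand_cons, expand_cons, lifts, lifts, List.map_cons, List.sum_cons]
      abel
    · rw [List.map_cons, search]
      refine mem_foldr (fun s l => ?_) (mem_splittings hi.1 hi.2.1 hi.2.2.1 hi.2.2.2) (fun l => ?_) _
      · rw [Bool.cond_eq_ite]
        split_ifs
        · exact subset_search _ _ _ _ _ _ _
        · exact fun _ h => h
      · have h1 : parity k (Nat.land i.2.2 (Nat.xor p δ)) = 0 := by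
          rw [parity_eq_zero_iff, hvδ, dotProduct_add, dotProduct_smul, smul_eq_mul]
          have h0 : (R.map fun i' => (T i'.1 : ZMod 2) * (vec k i.2.2 ⬝ᵥ vec k i'.1)).sum = 0 := by
            refine List.sum_eq_zero fun a ha => ?_
            obtain ⟨i', hi', rfl⟩ := List.mem_map.1 ha
            rw [hR.1 i' hi', mul_zero]
          have := hp (vec k i.2.2)
          rwa [h0, add_zero] at this
        have h2 : Nat.land (pack ((vectors k).map g) + pack ((vectors k).map fun f =>
            contribution (T i.1) i.2.1 (f ⬝ᵥ vec k i.1).val) + 111 * ones k) (128 * ones k) = 0 := by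
          rw [pack_map_add]
          exact land_pack_add_eq_zero fun f => by have := hg f; omega
        simp only [← hδ, h1, h2, Nat.beq_refl, Bool.and_self, cond_true]
        rw [pack_map_add]
        exact hmem l

/-- The number of nonzero columns. -/
def total (R : Table) : ℕ := (R.map fun i => i.2.1).sum

/-- All columns with their multiplicities, the zero column included. -/
def fullTable (R : Table) : List (ℕ × ℕ) := (0, 21 - total R) :: R.map fun i => (i.1, i.2.1)

/-- The columns of a table as vectors of length `k`. -/
def decode (k : ℕ) (R : Table) : Multiset (Fin k → ZMod 2) := (expand (fullTable R)).map (vec k)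

/-- The admissible extensions of a table by one dimension, the new column having the largest
multiplicity among the nonzero columns. -/
def extensions (k : ℕ) (R : Table) : List (List (ℕ × ℕ)) :=
  (List.range (21 - total R)).foldr (fun j out =>
    search k (ones k) (R.map fun i => (i, splittings k (j + 1) i.1 i.2.1)) ((j + 1) * ones k) 0
      [(0, 20 - total R - j), (1, j + 1)] out) []

/-- The conditions on a table that the search relies on. -/
def wellFormed (k : ℕ) (R : Table) : Bool :=
  wellTested k R && (decide (0 :: R.map fun i => i.1).Nodup && R.all fun i => Nat.blt i.1 (2 ^ k))

/-- The linear map whose values on unit vectors are the digits of `a` in base `b`. -/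
def applyDigits : ℕ → ℕ → ℕ → ℕ → ℕ
  | 0, _, _, _ => 0
  | n + 1, b, a, c => bif Nat.beq (c % 2) 0 then applyDigits n b (a / b) (c / 2)
    else Nat.xor (a % b) (applyDigits n b (a / b) (c / 2))

/-- A number that determines a multiset of less than `32` columns. -/
def encode (L : List (ℕ × ℕ)) : ℕ := (L.map fun p => p.2 * 32 ^ p.1).sum

/-- The certificate `a` consists of the index of a code and the images of the unit vectors under a
linear map that takes the columns `L` to the columns of this code. -/
def certify (k : ℕ) (codes : List ℕ) (a : ℕ) (L : List (ℕ × ℕ)) : Bool :=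
  match codes[a % 64]? with
  | some c => Nat.beq (encode (L.map fun p => (applyDigits k (2 ^ k) (a / 64) p.1, p.2))) c
  | none => false

def certifyAll (k : ℕ) (codes : List ℕ) : List (List (ℕ × ℕ)) → List ℕ → Bool
  | [], _ => true
  | _ :: _, [] => false
  | L :: Ls, a :: as => certify k codes a L && certifyAll k codes Ls as

def certifyExtensions (k : ℕ) (codes : List ℕ) : List Table → List (List ℕ) → Bool
  | [], _ => true
  | _ :: _, [] => false
  | R :: Rs, a :: as => wellFormed k R && certifyAll (k + 1) codes (extensions k R) a &&
      certifyExtensions k codes Rs as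

theorem certify_of_certifyAll {k : ℕ} {codes : List ℕ} {Ls : List (List (ℕ × ℕ))} {as : List ℕ}
    (h : certifyAll k codes Ls as = true) {L : List (ℕ × ℕ)} (hL : L ∈ Ls) :
    ∃ a, certify k codes a L = true := by
  induction Ls generalizing as with
  | nil => simp at hL
  | cons L' Ls ih =>
    cases as with
    | nil => simp [certifyAll] at h
    | cons a as =>
      rw [certifyAll, Bool.and_eq_true] at h
      rcases List.mem_cons.1 hL with rfl | hL
      · exact ⟨a, h.1⟩
      · exact ih h.2 hL

theorem certify_of_certifyExtensions {k : ℕ} {codes : List ℕ} {Rs : List Table}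
    {as : List (List ℕ)} (h : certifyExtensions k codes Rs as = true) {R : Table} (hR : R ∈ Rs) :
    wellFormed k R = true ∧ ∀ L ∈ extensions k R, ∃ a, certify (k + 1) codes a L = true := by
  induction Rs generalizing as with
  | nil => simp at hR
  | cons R' Rs ih =>
    cases as with
    | nil => simp [certifyExtensions] at h
    | cons a as =>
      rw [certifyExtensions, Bool.and_eq_true, Bool.and_eq_true] at h
      rcases List.mem_cons.1 hR with rfl | hR
      · exact ⟨h.1.1, fun L hL => certify_of_certifyAll h.1.2 hL⟩
      · exact ih h.2 hR

theorem exists_linearMap_applyDigits (n k a : ℕ) :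
    ∃ L : (Fin n → ZMod 2) →ₗ[ZMod 2] (Fin k → ZMod 2),
      ∀ c, vec k (applyDigits n (2 ^ k) a c) = L (vec n c) := by
  induction n generalizing a with
  | zero => exact ⟨0, fun c => by simp [applyDigits, vec_zero]⟩
  | succ n ih =>
    obtain ⟨L, hL⟩ := ih (a / 2 ^ k)
    refine ⟨(LinearMap.proj 0).smulRight (vec k (a % 2 ^ k)) + L ∘ₗ tail n, fun c => ?_⟩
    rw [LinearMap.add_apply, LinearMap.comp_apply, vec_succ, tail_vecCons, ← hL, applyDigits]
    rcases Nat.mod_two_eq_zero_or_one c with h | h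
    · simp [h, (ZMod.natCast_eq_zero_iff_even).2 (Nat.even_iff.2 h)]
    · simp only [h, (ZMod.natCast_eq_one_iff_odd).2 (Nat.odd_iff.2 h),
        show Nat.beq 1 0 = false from rfl, cond_false, vec_xor]
      simp

theorem eq_of_sum_mul_pow_eq {b n : ℕ} {d d' : ℕ → ℕ} (hd : ∀ c, d c < b) (hd' : ∀ c, d' c < b)
    (h : ∑ c ∈ Finset.range n, d c * b ^ c = ∑ c ∈ Finset.range n, d' c * b ^ c) :
    ∀ c < n, d c = d' c := by
  induction n generalizing d d' with
  | zero => intro c hc; omega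
  | succ n ih =>
    have hs : ∀ e : ℕ → ℕ, ∑ c ∈ Finset.range (n + 1), e c * b ^ c =
        e 0 + b * ∑ c ∈ Finset.range n, e (c + 1) * b ^ c := by
      intro e
      rw [Finset.sum_range_succ', Finset.mul_sum, add_comm, pow_zero, mul_one]
      congr 1
      exact Finset.sum_congr rfl fun c _ => by ring
    rw [hs, hs] at h
    have hb : 0 < b := (Nat.zero_le _).trans_lt (hd 0)
    have h0 : d 0 = d' 0 := by
      have := congrArg (· % b) h
      simpa [Nat.add_mul_mod_self_left, Nat.mod_eq_of_lt (hd 0), Nat.mod_eq_of_lt (hd' 0)] using this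
    rw [h0, add_right_inj] at h
    have := ih (fun c => hd (c + 1)) (fun c => hd' (c + 1)) (Nat.eq_of_mul_eq_mul_left hb h)
    rintro (_ | c) hc
    · exact h0
    · exact this c (by omega)

theorem eq_of_sum_pow_eq {s t : Multiset ℕ} (hs : s.card < 32) (ht : t.card < 32)
    (h : (s.map fun c => 32 ^ c).sum = (t.map fun c => 32 ^ c).sum) : s = t := by
  have hsum : ∀ (u : Multiset ℕ) (n : ℕ), (∀ c ∈ u, c < n) →
      (u.map fun c => 32 ^ c).sum = ∑ c ∈ Finset.range n, u.count c * 32 ^ c := by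
    intro u n hn
    rw [Finset.sum_multiset_map_count]
    refine Finset.sum_subset (fun c hc => ?_) (fun c _ hc => ?_)
    · exact Finset.mem_range.2 (hn c (Multiset.mem_toFinset.1 hc))
    · rw [Multiset.count_eq_zero_of_notMem (fun h => hc (Multiset.mem_toFinset.2 h)), zero_smul]
  obtain ⟨n, hn⟩ : ∃ n, ∀ c ∈ s + t, c < n :=
    ⟨(s + t).sum + 1, fun c hc => Nat.lt_succ_of_le (Multiset.single_le_sum (fun _ _ => Nat.zero_le _) c hc)⟩
  rw [hsum s n fun c hc => hn c (Multiset.mem_add.2 (Or.inl hc)),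
    hsum t n fun c hc => hn c (Multiset.mem_add.2 (Or.inr hc))] at h
  have := eq_of_sum_mul_pow_eq (fun c => (Multiset.count_le_card c s).trans_lt hs)
    (fun c => (Multiset.count_le_card c t).trans_lt ht) h
  ext c
  by_cases hc : c < n
  · exact this c hc
  · rw [Multiset.count_eq_zero_of_notMem fun h => hc (hn c (Multiset.mem_add.2 (Or.inl h))),
      Multiset.count_eq_zero_of_notMem fun h => hc (hn c (Multiset.mem_add.2 (Or.inr h)))]

theorem encode_eq (L : List (ℕ × ℕ)) : encode L = ((expand L).map fun c => 32 ^ c).sum := by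
  induction L with
  | nil => rfl
  | cons p L ih =>
    rw [expand_cons, Multiset.map_add, Multiset.sum_add, ← ih]
    simp [encode]

theorem expand_map_fst (L : List (ℕ × ℕ)) (g : ℕ → ℕ) :
    expand (L.map fun p => (g p.1, p.2)) = (expand L).map g := by
  induction L with
  | nil => rfl
  | cons p L ih => simp [expand_cons, ih]

theorem exists_of_certify {k a : ℕ} {Rs : List Table} {L : List (ℕ × ℕ)}
    (h : certify k (Rs.map fun R => encode (fullTable R)) a L = true) (hL : (expand L).card = 21)
    (hRs : ∀ R ∈ Rs, (decode k R).card = 21) :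
    ∃ R ∈ Rs, ∃ E : (Fin k → ZMod 2) →ₗ[ZMod 2] (Fin k → ZMod 2),
      ((expand L).map (vec k)).map E = decode k R := by
  rw [certify, List.getElem?_map] at h
  cases hR : Rs[a % 64]? with
  | none => simp [hR] at h
  | some R =>
    have hmem : R ∈ Rs := List.mem_of_getElem? hR
    simp only [hR, Option.map_some, Nat.beq_eq] at h
    obtain ⟨E, hE⟩ := exists_linearMap_applyDigits k k (a / 64)
    refine ⟨R, hmem, E, ?_⟩
    have hc := hRs R hmem
    rw [decode, Multiset.card_map] at hc
    rw [encode_eq, encode_eq, expand_map_fst L (applyDigits k (2 ^ k) (a / 64))] at h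
    have := eq_of_sum_pow_eq (by rw [Multiset.card_map]; omega) (by omega) h
    rw [decode, ← this, Multiset.map_map, Multiset.map_map]
    exact Multiset.map_congr rfl fun c _ => (hE c).symm

theorem eq_sum_fibres {α β : Type*} [DecidableEq β] (f : α → β) {l : List β} (hl : l.Nodup)
    {S : Multiset α} (hS : ∀ x ∈ S, f x ∈ l) :
    S = (l.map fun u => S.filter fun x => f x = u).sum := by
  induction l generalizing S with
  | nil => exact Multiset.eq_zero_of_forall_notMem fun x hx => by simpa using hS x hx
  | cons u l ih =>
    rw [List.nodup_cons] at hl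
    rw [List.map_cons, List.sum_cons]
    conv_lhs => rw [← Multiset.filter_add_not (fun x => f x = u) S]
    congr 1
    rw [ih hl.2 (S := S.filter fun x => ¬f x = u) fun x hx => ?_]
    · congr 1
      refine List.map_congr_left fun u' hu' => ?_
      rw [Multiset.filter_filter]
      refine Multiset.filter_congr fun x _ => ?_
      constructor
      · exact fun h => h.1
      · rintro rfl
        exact ⟨rfl, fun h => hl.1 (h ▸ hu')⟩
    · rw [Multiset.mem_filter] at hx
      exact (List.mem_cons.1 (hS x hx.1)).resolve_left hx.2

theorem eq_vecCons_iff {k : ℕ} (x : Fin (k + 1) → ZMod 2) (b : ZMod 2) (u : Fin k → ZMod 2) :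
    x = Matrix.vecCons b u ↔ x 0 = b ∧ tail k x = u := by
  rw [← vecCons_tail x, Matrix.vecCons_inj, tail_vecCons, Matrix.cons_val_zero]

theorem filter_tail_eq {k : ℕ} (S : Multiset (Fin (k + 1) → ZMod 2)) (u : Fin k → ZMod 2) :
    S.filter (fun x => tail k x = u) =
      Multiset.replicate (S.count (Matrix.vecCons 0 u)) (Matrix.vecCons 0 u) +
        Multiset.replicate (S.count (Matrix.vecCons 1 u)) (Matrix.vecCons 1 u) := by
  rw [← Multiset.filter_eq', ← Multiset.filter_eq', Multiset.filter_add_filter]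
  have h : S.filter (fun x => x = Matrix.vecCons 0 u ∧ x = Matrix.vecCons 1 u) = 0 := by
    rw [Multiset.filter_eq_nil]
    rintro x - ⟨rfl, h⟩
    exact absurd (Matrix.vecCons_inj.1 h).1 (by decide)
  rw [h, add_zero]
  refine Multiset.filter_congr fun x _ => ?_
  rw [eq_vecCons_iff, eq_vecCons_iff, ← or_and_right]
  simp [zmod_two_cases]

theorem count_map_tail {k : ℕ} (S : Multiset (Fin (k + 1) → ZMod 2)) (u : Fin k → ZMod 2) :
    (S.map (tail k)).count u =
      S.count (Matrix.vecCons 0 u) + S.count (Matrix.vecCons 1 u) := by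
  rw [Multiset.count_map]
  have := congrArg Multiset.card (filter_tail_eq S u)
  simpa [eq_comm] using this

theorem exists_of_mem_expand {L : List (ℕ × ℕ)} {c : ℕ} (h : c ∈ expand L) :
    ∃ p ∈ L, p.1 = c := by
  induction L with
  | nil => simp [expand] at h
  | cons q L ih =>
    rw [expand_cons, Multiset.mem_add] at h
    rcases h with h | h
    · exact ⟨q, List.mem_cons_self, (Multiset.eq_of_mem_replicate h).symm⟩
    · obtain ⟨p, hp, hc⟩ := ih h
      exact ⟨p, List.mem_cons_of_mem _ hp, hc⟩

theorem count_expand_map {α : Type*} [DecidableEq α] {g : ℕ → α} {L : List (ℕ × ℕ)}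
    (hL : (L.map fun p => g p.1).Nodup) {p : ℕ × ℕ} (hp : p ∈ L) :
    ((expand L).map g).count (g p.1) = p.2 := by
  induction L with
  | nil => simp at hp
  | cons q L ih =>
    rw [List.map_cons, List.nodup_cons] at hL
    rw [expand_cons, Multiset.map_add, Multiset.map_replicate, Multiset.count_add,
      Multiset.count_replicate]
    rcases List.mem_cons.1 hp with rfl | hp
    · have : g p.1 ∉ (expand L).map g := by
        intro h
        obtain ⟨c, hc, hcg⟩ := Multiset.mem_map.1 h
        obtain ⟨q, hq, rfl⟩ := exists_of_mem_expand hc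
        exact hL.1 (List.mem_map.2 ⟨q, hq, hcg⟩)
      rw [if_pos rfl, Multiset.count_eq_zero_of_notMem this, add_zero]
    · rw [if_neg fun h => hL.1 (List.mem_map.2 ⟨p, hp, h.symm⟩), ih hL.2 hp, zero_add]

theorem sum_map_list_sum {α β : Type*} (l : List β) (F : β → Multiset α) (g : α → ℕ) :
    ((l.map F).sum.map g).sum = (l.map fun b => ((F b).map g).sum).sum := by
  induction l with
  | nil => rfl
  | cons b l ih => simp [ih]

/-- An admissible multiset in suitable coordinates is found by the search. -/
theorem exists_mem_extensions {k : ℕ} {R : Table} (hR : wellFormed k R = true)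
    {S : Multiset (Fin (k + 1) → ZMod 2)} (hS : Admissible S)
    (htail : S.map (tail k) = decode k R) (hpos : 0 < S.count (Matrix.vecCons 1 0))
    (hmax : ∀ v, v ≠ 0 → S.count v ≤ S.count (Matrix.vecCons 1 0))
    (hunit : ∀ i : Fin k, S.count (Matrix.vecCons 1 (Pi.single i 1)) ≤
      S.count (Matrix.vecCons 0 (Pi.single i 1))) :
    ∃ L ∈ extensions k R, (expand L).map (vec (k + 1)) = S := by
  simp only [wellFormed, Bool.and_eq_true, decide_eq_true_eq, List.all_eq_true] at hR
  obtain ⟨hwt, hnd, hlt⟩ := hR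
  have hnd' : ((fullTable R).map fun p => vec k p.1).Nodup := by
    have h1 : (fullTable R).map (fun p => vec k p.1) = (0 :: R.map fun i => i.1).map (vec k) := by
      simp [fullTable]
    rw [h1]
    refine hnd.map_on fun a ha b hb h => vec_inj ?_ ?_ h
    all_goals
      have hmem : ∀ c ∈ (0 :: R.map fun i => i.1), c < 2 ^ k := by
        intro c hc
        rcases List.mem_cons.1 hc with rfl | hc
        · positivity
        · obtain ⟨i, hi, rfl⟩ := List.mem_map.1 hc
          exact Nat.blt_eq.mp (hlt i hi)
      exact hmem _ ‹_›
  set T : ℕ → ℕ := fun y => S.count (Matrix.vecCons 1 (vec k y)) with hT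
  have hcount : ∀ p ∈ fullTable R, S.count (Matrix.vecCons 0 (vec k p.1)) + T p.1 = p.2 := by
    intro p hp
    rw [hT, ← count_map_tail, htail]
    exact count_expand_map hnd' hp
  have hT0 : T 0 = S.count (Matrix.vecCons 1 0) := by simp only [hT, vec_zero]
  have hsplit : S = ((fullTable R).map fun p =>
      Multiset.replicate (p.2 - T p.1) (Matrix.vecCons 0 (vec k p.1)) +
        Multiset.replicate (T p.1) (Matrix.vecCons 1 (vec k p.1))).sum := by
    conv_lhs => rw [eq_sum_fibres (tail k) hnd' (S := S) fun x hx => by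
      have : tail k x ∈ decode k R := htail ▸ Multiset.mem_map_of_mem _ hx
      obtain ⟨c, hc, hcx⟩ := Multiset.mem_map.1 this
      obtain ⟨p, hp, rfl⟩ := exists_of_mem_expand hc
      exact List.mem_map.2 ⟨p, hp, hcx⟩]
    rw [List.map_map]
    refine congrArg List.sum (List.map_congr_left fun p hp => ?_)
    rw [Function.comp_apply, filter_tail_eq, ← hcount p hp, Nat.add_sub_cancel]
  have hsum : ∀ g : (Fin (k + 1) → ZMod 2) → ℕ, (S.map g).sum = ((fullTable R).map fun p =>
      (p.2 - T p.1) * g (Matrix.vecCons 0 (vec k p.1)) +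
        T p.1 * g (Matrix.vecCons 1 (vec k p.1))).sum := by
    intro g
    conv_lhs => rw [hsplit, sum_map_list_sum]
    simp
  have hmemR : ∀ i ∈ R, (i.1, i.2.1) ∈ fullTable R := fun i hi =>
    List.mem_cons_of_mem _ (List.mem_map.2 ⟨i, hi, rfl⟩)
  have h0 := hcount (0, 21 - total R) List.mem_cons_self
  have hvec0 : ∀ i ∈ R, vec k i.1 ≠ 0 := by
    intro i hi h
    rw [fullTable, List.map_cons, List.nodup_cons] at hnd'
    refine hnd'.1 (List.mem_map.2 ⟨(i.1, i.2.1), List.mem_map.2 ⟨i, hi, rfl⟩, ?_⟩)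
    rw [vec_zero]
    exact h
  have hbounds : SplittingBounds k (T 0) T R := by
    intro i hi
    have hc := hcount _ (hmemR i hi)
    have hne : ∀ b : ZMod 2, Matrix.vecCons b (vec k i.1) ≠ 0 := fun b h =>
      hvec0 i hi (by rw [← tail_vecCons b (vec k i.1), h, map_zero])
    have h1 := hmax _ (hne 0)
    have h2 := hmax _ (hne 1)
    simp only at hc
    refine ⟨by omega, by rw [hT0]; exact h2, by omega, fun n hn hni => ?_⟩
    have h3 := hunit ⟨n, hn⟩
    rw [← vec_two_pow, hni] at h3
    change T i.1 ≤ _ at h3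
    omega
  have hw : ∀ f : Fin k → ZMod 2, wt S (dotProductEquiv (ZMod 2) _ (Matrix.vecCons 1 f)) =
      T 0 + (R.map fun i => contribution (T i.1) i.2.1 (f ⬝ᵥ vec k i.1).val).sum := by
    intro f
    rw [wt, hsum, fullTable, List.map_cons, List.sum_cons, List.map_map]
    congr 1
    · simp [vec_zero, ZMod.val_one]
    · refine congrArg List.sum (List.map_congr_left fun i _ => ?_)
      simpa [contribution, val_one_add] using add_comm _ _
  have hp : ∀ f : Fin k → ZMod 2,
      (R.map fun i => (T i.1 : ZMod 2) * (f ⬝ᵥ vec k i.1)).sum = 0 := by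
    intro f
    have h2 := hS.two_dvd_inter (dotProductEquiv (ZMod 2) _ (Matrix.vecCons 1 0))
      (dotProductEquiv (ZMod 2) _ (Matrix.vecCons 0 f))
    rw [hsum, ← ZMod.natCast_eq_zero_iff, fullTable, List.map_cons, List.sum_cons,
      List.map_map, Nat.cast_add, Nat.cast_list_sum, List.map_map] at h2
    rw [← h2]
    simp [vec_zero, Function.comp_def]
  obtain ⟨L, hL, hmem⟩ := exists_mem_search hwt hbounds (fun _ => T 0) 0
    [(0, 21 - total R - T 0), (1, T 0)]
    (fun f => by
      rw [← hw]
      refine hS _ fun h => ?_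
      rw [LinearEquiv.map_eq_zero_iff] at h
      exact one_ne_zero (congrFun h 0))
    (fun f => by rw [vec_zero, dotProduct_zero, zero_add, hp])
  refine ⟨L, ?_, ?_⟩
  · refine mem_foldr (a := T 0 - 1) (fun j l => subset_search _ _ _ _ _ _ _) ?_ (fun l => ?_) _
    · simp only at h0
      rw [List.mem_range]
      omega
    · rw [show T 0 - 1 + 1 = T 0 by omega, mul_ones,
        show 20 - total R - (T 0 - 1) = 21 - total R - T 0 by omega]
      exact hmem l
  · rw [hL]
    conv_rhs => rw [hsplit, fullTable, List.map_cons, List.sum_cons, List.map_map]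
    rw [Multiset.map_add]
    congr 1
    · simp [expand, ← vec_two_mul, ← vec_two_mul_add_one]
    · rw [lifts, ← Multiset.coe_mapAddMonoidHom, map_list_sum, List.map_map]
      refine congrArg List.sum (List.map_congr_left fun i _ => ?_)
      simp [vec_two_mul, vec_two_mul_add_one]

/-- Up to linear maps every admissible multiset of `21` columns is given by one of the tables. -/
def Exhausts (k : ℕ) (Rs : List Table) : Prop :=
  ∀ (V : Type) [AddCommGroup V] [Module (ZMod 2) V] [Module.Finite (ZMod 2) V],
    finrank (ZMod 2) V = k → ∀ S : Multiset V, S.card = 21 → Admissible S →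
      ∃ R ∈ Rs, ∃ L : V →ₗ[ZMod 2] (Fin k → ZMod 2), S.map L = decode k R

/-- The tables represent admissible multisets of `21` columns. -/
def Represents (k : ℕ) (Rs : List Table) : Prop :=
  ∀ R ∈ Rs, (decode k R).card = 21 ∧ Admissible (decode k R)

theorem exhausts_zero : Exhausts 0 [[]] := by
  intro V _ _ _ hV S hS _
  refine ⟨[], by simp, 0, ?_⟩
  have : decode 0 [] = Multiset.replicate 21 0 := by
    simp [decode, expand, fullTable, total, vec_zero]
  rw [this, Multiset.eq_replicate]
  refine ⟨by rw [Multiset.card_map, hS], fun v _ => Subsingleton.elim _ _⟩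

theorem Exhausts.succ {k : ℕ} {Rs Rs' : List Table} {as : List (List ℕ)} (h : Exhausts k Rs)
    (hRs : Represents k Rs) (hRs' : Represents (k + 1) Rs')
    (hc : certifyExtensions k (Rs'.map fun R => encode (fullTable R)) Rs as = true) :
    Exhausts (k + 1) Rs' := by
  classical
  intro V _ _ _ hV S hcard hS
  obtain ⟨x, hx, hmax⟩ : ∃ x ∈ S.toFinset.filter (· ≠ 0),
      ∀ y ∈ S.toFinset.filter (· ≠ 0), S.count y ≤ S.count x := by
    refine Finset.exists_max_image _ _ ?_
    obtain ⟨x, hx, hx0⟩ := hS.exists_ne_zero (by omega)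
    exact ⟨x, by simp [hx, hx0]⟩
  simp only [Finset.mem_filter, Multiset.mem_toFinset] at hx hmax
  have hquot : finrank (ZMod 2) (V ⧸ (ZMod 2) ∙ x) = k := by
    have h1 := Submodule.finrank_quotient_add_finrank ((ZMod 2) ∙ x)
    rw [finrank_span_singleton hx.2] at h1
    omega
  obtain ⟨R, hR, L, hL⟩ := h (V ⧸ (ZMod 2) ∙ x) hquot (S.map (Submodule.mkQ _))
    (by rw [Multiset.card_map, hcard]) (hS.map (Submodule.mkQ_surjective _))
  have hLb : Function.Bijective L := by
    refine Admissible.bijective (S := S.map (Submodule.mkQ _)) ?_ (by simp [hquot])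
    rw [hL]
    exact (hRs R hR).2
  obtain ⟨B, hB, hBx, htail, hunit⟩ := exists_coordinates hV hx.2 L hLb hL
  obtain ⟨hwf, hcert⟩ := certify_of_certifyExtensions hc hR
  have hcx : (S.map B).count (Matrix.vecCons 1 0) = S.count x := by
    rw [← hBx, Multiset.count_map_eq_count' _ _ hB.1]
  obtain ⟨E, hE, hES⟩ := exists_mem_extensions hwf (hS.map hB.2) htail
    (by rw [hcx]; exact Multiset.count_pos.2 hx.1)
    (fun v hv => by
      obtain ⟨y, rfl⟩ := hB.2 v
      rw [hcx, Multiset.count_map_eq_count' _ _ hB.1]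
      by_cases hy : y ∈ S
      · exact hmax y ⟨hy, fun h0 => hv (by rw [h0, map_zero])⟩
      · rw [Multiset.count_eq_zero_of_notMem hy]
        exact Nat.zero_le _) hunit
  obtain ⟨a, ha⟩ := hcert E hE
  obtain ⟨R', hR', A, hA⟩ := exists_of_certify ha
    (by rw [← Multiset.card_map (vec (k + 1)), hES, Multiset.card_map, hcard])
    (fun R hR => (hRs' R hR).1)
  refine ⟨R', hR', A ∘ₗ B, ?_⟩
  rw [← hA, hES, Multiset.map_map]
  rfl

/-! ### Weights and invariants of tables -/

/-- The weights of all functionals. -/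
def weights (k : ℕ) (R : Table) : List ℕ :=
  R.foldr (fun i w => List.zipWith (fun a d => a + i.2.1 * d) w (dots k i.1)) (dots k 0)

/-- All nonzero functionals have weight `8`, `12` or `16`, there are at most `21` columns, and their
length is at most `k`. -/
def allowed (k : ℕ) (R : Table) : Bool :=
  Nat.ble (total R) 21 && (R.all fun i => Nat.blt i.1 (2 ^ k)) &&
    (weights k R).tail.all fun w => Nat.beq w 8 || Nat.beq w 12 || Nat.beq w 16

/-- The sum of the squares of the weights of the functionals that do not vanish on a column. -/
def columnMoment (k : ℕ) (w : List ℕ) (y : ℕ) : ℕ :=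
  (List.zipWith (fun a d => d * a ^ 2) w (dots k y)).sum

/-- The sum over all functionals of the cubes of the sums of the column moments. -/
def moment (k : ℕ) (R : Table) : ℕ :=
  ((R.foldr (fun i w => List.zipWith
    (fun a d => a + i.2.1 * (d * columnMoment k (weights k R) i.1)) w (dots k i.1))
      (dots k 0)).map fun a => a ^ 3).sum

/-- Whether the columns contain three vectors together with all sums of two or three of them. -/
def hasPlane (C : List ℕ) : Bool :=
  C.any fun x => C.any fun y => C.contains (Nat.xor x y) && C.any fun z =>
    C.contains (Nat.xor x z) && C.contains (Nat.xor y z) && C.contains (Nat.xor (Nat.xor x y) z)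

/-- The nonzero columns, preceded by the zero column if it occurs. -/
def support (R : Table) : List ℕ :=
  ((fullTable R).filter fun p => Nat.blt 0 p.2).map Prod.fst

/-- Whether the invariants of two tables differ. -/
def separated (k : ℕ) (R R' : Table) : Bool :=
  !Nat.beq (moment k R) (moment k R') || (hasPlane (support R) != hasPlane (support R'))

/-- All tables are admissible and their invariants differ. -/
def certifyTables (k : ℕ) : List Table → Bool
  | [] => true
  | R :: Rs => allowed k R && (Rs.all (separated k R) && certifyTables k Rs)

theorem sum_map_decode (k : ℕ) (R : Table) (g : (Fin k → ZMod 2) → ℕ) :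
    ((decode k R).map g).sum =
      (21 - total R) * g 0 + (R.map fun i => i.2.1 * g (vec k i.1)).sum := by
  have h : ∀ L : List (ℕ × ℕ), (((expand L).map (vec k)).map g).sum =
      (L.map fun p => p.2 * g (vec k p.1)).sum := by
    intro L
    induction L with
    | nil => rfl
    | cons p L ih =>
      rw [expand_cons, Multiset.map_add, Multiset.map_add, Multiset.sum_add, ih]
      simp
  rw [decode, h, fullTable, List.map_cons, List.sum_cons, List.map_map, vec_zero]
  rfl

theorem card_decode {k : ℕ} {R : Table} (h : total R ≤ 21) : (decode k R).card = 21 := by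
  have := sum_map_decode k R fun _ => 1
  simp only [Multiset.map_const', Multiset.sum_replicate, smul_eq_mul, mul_one] at this
  rw [this, ← total]
  omega

theorem zipWith_map_self {α : Type*} (l : List α) (f g : α → ℕ) (h : ℕ → ℕ → ℕ) :
    List.zipWith h (l.map f) (l.map g) = l.map fun x => h (f x) (g x) := by
  induction l with
  | nil => rfl
  | cons a l ih => simp [ih]

theorem foldr_zipWith_dots (k : ℕ) (R : Table) (c : ℕ → ℕ) :
    R.foldr (fun i w => List.zipWith (fun a d => a + i.2.1 * (d * c i.1)) w (dots k i.1))
      (dots k 0) = (vectors k).map fun f =>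
        (R.map fun i => i.2.1 * ((f ⬝ᵥ vec k i.1).val * c i.1)).sum := by
  induction R with
  | nil => simp [dots_eq, vec_zero]
  | cons i R ih =>
    rw [List.foldr_cons, ih, dots_eq, zipWith_map_self]
    simp [add_comm]

theorem wt_decode (k : ℕ) (R : Table) (f : Fin k → ZMod 2) :
    wt (decode k R) (dotProductEquiv (ZMod 2) _ f) =
      (R.map fun i => i.2.1 * (f ⬝ᵥ vec k i.1).val).sum := by
  rw [wt, sum_map_decode]
  simp

theorem weights_eq (k : ℕ) (R : Table) :
    weights k R = (vectors k).map fun f => wt (decode k R) (dotProductEquiv (ZMod 2) _ f) := by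
  have h := foldr_zipWith_dots k R fun _ => 1
  simp only [mul_one] at h
  simp only [weights, h, wt_decode]

theorem admissible_of_allowed {k : ℕ} {R : Table} (h : allowed k R = true) :
    (decode k R).card = 21 ∧ Admissible (decode k R) := by
  simp only [allowed, Bool.and_eq_true, Nat.ble_eq, List.all_eq_true, Bool.or_eq_true,
    Nat.beq_eq] at h
  refine ⟨card_decode h.1.1, fun φ hφ => ?_⟩
  obtain ⟨f, rfl⟩ := (dotProductEquiv (ZMod 2) (Fin k)).surjective φ
  obtain ⟨l, hl⟩ := vectors_eq_cons k
  rw [weights_eq, hl, List.map_cons, List.tail_cons] at h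
  have hf : f ∈ l := by
    have := mem_vectors f
    rw [hl] at this
    refine (List.mem_cons.1 this).resolve_left fun h0 => hφ ?_
    rw [h0, map_zero]
  have := h.2 _ (List.mem_map_of_mem hf)
  tauto

/-- The moment of a multiset of vectors. -/
def vectorMoment {k : ℕ} (S : Multiset (Fin k → ZMod 2)) : ℕ :=
  ∑ f : Fin k → ZMod 2, ((S.map fun x => (f ⬝ᵥ x).val *
    ∑ g : Fin k → ZMod 2, (g ⬝ᵥ x).val * wt S (dotProductEquiv (ZMod 2) _ g) ^ 2).sum) ^ 3

theorem vectorMoment_map {k : ℕ} (S : Multiset (Fin k → ZMod 2))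
    {L : (Fin k → ZMod 2) →ₗ[ZMod 2] (Fin k → ZMod 2)} (hL : Function.Bijective L) :
    vectorMoment (S.map L) = vectorMoment S := by
  let e : (Fin k → ZMod 2) ≃ (Fin k → ZMod 2) := ((dotProductEquiv (ZMod 2) (Fin k)).trans
    ((LinearEquiv.ofBijective L hL).dualMap.trans (dotProductEquiv (ZMod 2) (Fin k)).symm)).toEquiv
  have he' : ∀ f, dotProductEquiv (ZMod 2) (Fin k) (e f) = dotProductEquiv (ZMod 2) (Fin k) f ∘ₗ L := by
    intro f
    simp only [e, LinearEquiv.coe_toEquiv, LinearEquiv.trans_apply, LinearEquiv.apply_symm_apply]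
    rfl
  have he : ∀ f x, f ⬝ᵥ L x = e f ⬝ᵥ x := fun f x => (LinearMap.congr_fun (he' f) x).symm
  have hw : ∀ g, wt (S.map L) (dotProductEquiv (ZMod 2) _ g) =
      wt S (dotProductEquiv (ZMod 2) _ (e g)) := by
    intro g
    rw [wt_map, he']
  simp only [vectorMoment, Multiset.map_map, Function.comp_def, he, hw]
  have hin : ∀ x, ∑ g, (e g ⬝ᵥ x).val * wt S (dotProductEquiv (ZMod 2) _ (e g)) ^ 2 =
      ∑ g, (g ⬝ᵥ x).val * wt S (dotProductEquiv (ZMod 2) _ g) ^ 2 := fun x =>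
    e.sum_comp fun g => (g ⬝ᵥ x).val * wt S (dotProductEquiv (ZMod 2) _ g) ^ 2
  simp only [hin]
  exact e.sum_comp fun f => ((S.map fun x => (f ⬝ᵥ x).val *
    ∑ g, (g ⬝ᵥ x).val * wt S (dotProductEquiv (ZMod 2) _ g) ^ 2).sum) ^ 3

theorem columnMoment_eq (k : ℕ) (R : Table) (y : ℕ) : columnMoment k (weights k R) y =
    ∑ g : Fin k → ZMod 2, (g ⬝ᵥ vec k y).val *
      wt (decode k R) (dotProductEquiv (ZMod 2) _ g) ^ 2 := by
  rw [columnMoment, weights_eq, dots_eq, zipWith_map_self, sum_vectors]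

theorem moment_eq (k : ℕ) (R : Table) : moment k R = vectorMoment (decode k R) := by
  rw [moment, foldr_zipWith_dots, List.map_map, sum_vectors, vectorMoment]
  refine Finset.sum_congr rfl fun f _ => ?_
  rw [sum_map_decode]
  simp [columnMoment_eq]

/-- Three vectors of `S` have all their sums in `S`. -/
def HasPlane {V : Type*} [Add V] (S : Multiset V) : Prop :=
  ∃ x ∈ S, ∃ y ∈ S, x + y ∈ S ∧ ∃ z ∈ S, (x + z ∈ S ∧ y + z ∈ S) ∧ x + y + z ∈ S

theorem hasPlane_map {V W : Type*} [AddCommGroup V] [Module (ZMod 2) V] [AddCommGroup W]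
    [Module (ZMod 2) W] (S : Multiset V) {L : V →ₗ[ZMod 2] W} (hL : Function.Injective L) :
    HasPlane (S.map L) ↔ HasPlane S := by
  simp only [HasPlane, Multiset.mem_map, exists_exists_and_eq_and, ← map_add, hL.eq_iff,
    exists_eq_right]

theorem mem_expand {L : List (ℕ × ℕ)} {c : ℕ} :
    c ∈ expand L ↔ ∃ p ∈ L, 0 < p.2 ∧ p.1 = c := by
  induction L with
  | nil => simp [expand]
  | cons q L ih =>
    simp only [expand_cons, Multiset.mem_add, Multiset.mem_replicate, ih, List.exists_mem_cons_iff,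
      Nat.pos_iff_ne_zero, eq_comm]

theorem mem_decode {k : ℕ} {R : Table} {v : Fin k → ZMod 2} :
    v ∈ decode k R ↔ ∃ c ∈ support R, vec k c = v := by
  simp only [decode, Multiset.mem_map, mem_expand, support, List.mem_map, List.mem_filter,
    Nat.blt_eq, and_assoc]

theorem hasPlane_support {k : ℕ} {R : Table} (h : ∀ i ∈ R, i.1 < 2 ^ k) :
    hasPlane (support R) = true ↔ HasPlane (decode k R) := by
  have hlt : ∀ c ∈ support R, c < 2 ^ k := by
    intro c hc
    obtain ⟨p, hp, rfl⟩ := List.mem_map.1 hc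
    rcases List.mem_cons.1 (List.mem_filter.1 hp).1 with rfl | hp
    · positivity
    · obtain ⟨i, hi, rfl⟩ := List.mem_map.1 hp
      exact h i hi
  have hmem : ∀ c < 2 ^ k, c ∈ support R ↔ vec k c ∈ decode k R := by
    intro c hc
    rw [mem_decode]
    exact ⟨fun h => ⟨c, h, rfl⟩, fun ⟨c', hc', h⟩ => vec_inj (hlt c' hc') hc h ▸ hc'⟩
  have hx : ∀ a b, a < 2 ^ k → b < 2 ^ k → Nat.xor a b < 2 ^ k := fun a b => Nat.xor_lt_two_pow
  simp only [hasPlane, List.any_eq_true, Bool.and_eq_true, List.contains_iff_mem, HasPlane]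
  constructor
  · rintro ⟨x, hxs, y, hys, hxy, z, hzs, ⟨hxz, hyz⟩, hxyz⟩
    have h1 := hlt x hxs
    have h2 := hlt y hys
    have h3 := hlt z hzs
    rw [hmem _ (hx _ _ h1 h2), vec_xor] at hxy
    rw [hmem _ (hx _ _ h1 h3), vec_xor] at hxz
    rw [hmem _ (hx _ _ h2 h3), vec_xor] at hyz
    rw [hmem _ (hx _ _ (hx _ _ h1 h2) h3), vec_xor, vec_xor] at hxyz
    exact ⟨_, (hmem x h1).1 hxs, _, (hmem y h2).1 hys, hxy, _, (hmem z h3).1 hzs, ⟨hxz, hyz⟩, hxyz⟩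
  · rintro ⟨_, hxs', _, hys', hxy, _, hzs', ⟨hxz, hyz⟩, hxyz⟩
    obtain ⟨x, hxs, rfl⟩ := mem_decode.1 hxs'
    obtain ⟨y, hys, rfl⟩ := mem_decode.1 hys'
    obtain ⟨z, hzs, rfl⟩ := mem_decode.1 hzs'
    have h1 := hlt x hxs
    have h2 := hlt y hys
    have h3 := hlt z hzs
    simp only [← vec_xor] at hxy hxz hyz hxyz
    exact ⟨x, hxs, y, hys, (hmem _ (hx _ _ h1 h2)).2 hxy, z, hzs,
      ⟨(hmem _ (hx _ _ h1 h3)).2 hxz, (hmem _ (hx _ _ h2 h3)).2 hyz⟩,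
      (hmem _ (hx _ _ (hx _ _ h1 h2) h3)).2 hxyz⟩

theorem not_exists_of_separated {k : ℕ} {R R' : Table} (hR : allowed k R = true)
    (hR' : allowed k R' = true) (h : separated k R R' = true) :
    ¬∃ L : (Fin k → ZMod 2) →ₗ[ZMod 2] (Fin k → ZMod 2), (decode k R).map L = decode k R' := by
  rintro ⟨L, hL⟩
  have hb : Function.Bijective L :=
    Admissible.bijective (S := decode k R) (by rw [hL]; exact (admissible_of_allowed hR').2) rfl
  have h1 : moment k R = moment k R' := by
    rw [moment_eq, moment_eq, ← hL, vectorMoment_map _ hb]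
  have hlt : ∀ {R : Table}, allowed k R = true → ∀ i ∈ R, i.1 < 2 ^ k := by
    intro R hR
    simp only [allowed, Bool.and_eq_true, List.all_eq_true] at hR
    exact fun i hi => Nat.blt_eq.mp (hR.1.2 i hi)
  have h2 : hasPlane (support R) = hasPlane (support R') := by
    rw [Bool.eq_iff_iff, hasPlane_support (hlt hR), hasPlane_support (hlt hR'), ← hL,
      hasPlane_map _ hb.1]
  simp [separated, h1, h2] at h

theorem represents_of_certifyTables {k : ℕ} {Rs : List Table} (h : certifyTables k Rs = true) :
    Represents k Rs ∧ Rs.Pairwise fun R R' =>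
      ¬∃ L : (Fin k → ZMod 2) →ₗ[ZMod 2] (Fin k → ZMod 2), (decode k R).map L = decode k R' := by
  suffices H : (∀ R ∈ Rs, allowed k R = true) ∧ Rs.Pairwise fun R R' => separated k R R' = true from
    ⟨fun R hR => admissible_of_allowed (H.1 R hR), H.2.imp_of_mem fun hR hR' hs =>
      not_exists_of_separated (H.1 _ hR) (H.1 _ hR') hs⟩
  induction Rs with
  | nil => simp
  | cons R Rs ih =>
    simp only [certifyTables, Bool.and_eq_true, List.all_eq_true] at h
    obtain ⟨h1, h2⟩ := ih h.2.2
    exact ⟨List.forall_mem_cons.2 ⟨h.1, h1⟩, List.pairwise_cons.2 ⟨h.2.1, h2⟩⟩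

/-- The number of classes of codes is the length of a certified exhaustive list of tables. -/
theorem r_eq_of_exhausts {Z : Type*} [Fintype Z] [DecidableEq Z] (hZ : Fintype.card Z = 21)
    {k σ : ℕ} (hk : k + 1 + σ = 11) {Rs : List Table} (hex : Exhausts k Rs)
    (h : certifyTables k Rs = true) : Code.r Z σ = Rs.length := by
  obtain ⟨h1, h2⟩ := represents_of_certifyTables h
  rw [← List.length_map (f := decode k)]
  refine r_eq_length hZ hk _ ?_ ?_ (List.pairwise_map.2 h2)
  · intro S hS
    obtain ⟨R, hR, rfl⟩ := List.mem_map.1 hS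
    exact h1 R hR
  · intro S hc hS
    obtain ⟨R, hR, L, hL⟩ := hex _ (by simp) S hc hS
    exact ⟨_, List.mem_map_of_mem hR, L, hL⟩

/-- Representatives of the admissible multisets of dimension `0`. -/
def tables0 : List Table := [
  []]

/-- Representatives of the admissible multisets of dimension `1`. -/
def tables1 : List Table := [
  [(1, 8, 1)],
  [(1, 12, 1)],
  [(1, 16, 1)]]

/-- Representatives of the admissible multisets of dimension `2`. -/
def tables2 : List Table := [
  [(1, 4, 0), (2, 4, 3), (3, 4, 1)],
  [(1, 6, 0), (2, 6, 3), (3, 2, 1)],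
  [(1, 8, 1), (2, 8, 2)],
  [(3, 8, 0), (1, 4, 1), (2, 4, 2)],
  [(1, 10, 0), (2, 6, 3), (3, 2, 1)],
  [(1, 12, 0), (2, 4, 3), (3, 4, 1)],
  [(1, 6, 0), (2, 6, 3), (3, 6, 1)],
  [(1, 8, 0), (2, 8, 3), (3, 4, 1)]]

/-- Representatives of the admissible multisets of dimension `3`. -/
def tables3 : List Table := [
  [(2, 2, 0), (4, 2, 0), (1, 2, 0), (7, 2, 7), (3, 2, 0), (5, 2, 1), (6, 2, 2)],
  [(2, 1, 0), (4, 1, 0), (1, 3, 0), (7, 3, 7), (6, 1, 0), (3, 3, 2), (5, 3, 1)],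
  [(1, 4, 0), (2, 4, 3), (4, 4, 5), (7, 4, 1)],
  [(1, 4, 0), (2, 2, 0), (5, 2, 3), (4, 2, 0), (3, 2, 5), (7, 4, 1)],
  [(2, 1, 0), (4, 1, 0), (1, 5, 0), (7, 1, 7), (3, 3, 0), (6, 3, 2), (5, 3, 1)],
  [(3, 6, 0), (2, 2, 2), (1, 2, 0), (4, 4, 5), (5, 4, 1)],
  [(7, 6, 0), (4, 2, 0), (1, 2, 0), (2, 2, 7), (6, 2, 0), (3, 2, 2), (5, 2, 1)],
  [(1, 7, 0), (2, 3, 0), (3, 1, 0), (4, 3, 0), (5, 1, 6), (6, 1, 3), (7, 3, 1)],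
  [(1, 8, 1), (2, 4, 0), (4, 4, 6), (6, 4, 2)],
  [(1, 8, 0), (2, 4, 0), (4, 2, 0), (5, 2, 6), (6, 2, 3), (7, 2, 1)],
  [(1, 9, 0), (2, 3, 0), (3, 1, 0), (4, 3, 0), (5, 1, 6), (6, 3, 3), (7, 1, 1)],
  [(2, 4, 0), (4, 2, 0), (1, 2, 7), (3, 4, 0), (5, 2, 1), (6, 4, 2)],
  [(1, 5, 0), (2, 5, 0), (3, 1, 0), (4, 5, 0), (5, 1, 6), (6, 1, 3), (7, 1, 1)],
  [(1, 5, 0), (2, 3, 0), (3, 3, 0), (4, 3, 0), (5, 3, 6), (6, 1, 3), (7, 1, 1)],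
  [(1, 6, 0), (2, 6, 0), (4, 4, 7), (5, 2, 1), (6, 2, 2)],
  [(1, 6, 0), (2, 4, 0), (3, 2, 0), (4, 4, 5), (5, 2, 3), (7, 2, 1)],
  [(1, 7, 0), (2, 5, 0), (3, 1, 0), (4, 3, 0), (5, 3, 6), (6, 1, 3), (7, 1, 1)],
  [(1, 4, 0), (2, 4, 0), (3, 4, 2), (4, 4, 5), (5, 4, 1)],
  [(1, 4, 0), (2, 4, 0), (3, 4, 0), (4, 2, 0), (5, 2, 6), (6, 2, 3), (7, 2, 1)],
  [(1, 5, 0), (2, 5, 0), (3, 3, 0), (4, 3, 0), (5, 1, 6), (6, 1, 3), (7, 3, 1)],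
  [(1, 3, 0), (2, 3, 0), (3, 3, 0), (4, 3, 0), (5, 3, 6), (6, 3, 3), (7, 3, 1)]]

/-- Representatives of the admissible multisets of dimension `4`. -/
def tables4 : List Table := [
  [(1, 1, 0), (2, 1, 0), (4, 1, 0), (8, 1, 0), (13, 1, 0), (7, 1, 0), (6, 1, 0), (11, 1, 0), (14,
    1, 15), (10, 1, 0), (3, 1, 0), (15, 1, 2), (9, 1, 0), (5, 1, 1), (12, 1, 4)],
  [(1, 2, 0), (2, 2, 0), (4, 2, 0), (7, 2, 7), (8, 2, 0), (11, 2, 11), (13, 2, 1), (14, 2, 2)],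
  [(1, 1, 0), (2, 1, 0), (4, 1, 0), (8, 1, 0), (13, 1, 0), (11, 1, 0), (14, 1, 0), (7, 1, 15), (5,
    2, 0), (3, 2, 1), (12, 2, 4), (10, 2, 2)],
  [(1, 1, 0), (4, 1, 0), (2, 3, 0), (8, 2, 0), (5, 1, 0), (3, 1, 14), (12, 2, 0), (7, 1, 7), (6,
    1, 0), (13, 2, 3), (11, 2, 1)],
  [(2, 2, 0), (1, 2, 0), (14, 4, 3), (8, 2, 0), (11, 2, 8), (4, 2, 0), (3, 2, 5), (7, 2, 1)],
  [(1, 1, 0), (2, 1, 0), (4, 1, 0), (8, 1, 0), (6, 4, 0), (7, 1, 0), (11, 1, 12), (13, 1, 0), (14,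
    1, 3), (15, 2, 0), (12, 2, 4), (3, 2, 1)],
  [(1, 5, 0), (2, 2, 0), (4, 2, 0), (6, 1, 0), (7, 1, 0), (8, 2, 0), (10, 1, 0), (11, 1, 12), (12,
    1, 7), (13, 1, 1), (14, 2, 2)],
  [(2, 1, 0), (4, 1, 0), (8, 1, 0), (1, 5, 0), (3, 1, 0), (5, 1, 0), (6, 1, 0), (7, 1, 0), (9, 1,
    0), (10, 1, 0), (11, 1, 12), (12, 1, 0), (13, 1, 6), (14, 1, 3), (15, 1, 1)],
  [(1, 6, 0), (2, 2, 0), (4, 2, 0), (6, 2, 0), (8, 2, 11), (10, 2, 7), (13, 2, 1), (14, 2, 2)],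
  [(8, 1, 0), (1, 6, 0), (2, 2, 0), (4, 2, 0), (7, 2, 0), (9, 1, 0), (10, 1, 0), (11, 1, 12), (12,
    1, 0), (13, 1, 6), (14, 1, 3), (15, 1, 1)],
  [(1, 7, 0), (2, 2, 0), (4, 2, 0), (6, 1, 0), (7, 1, 0), (8, 2, 0), (10, 1, 0), (11, 1, 12), (12,
    1, 5), (13, 1, 3), (15, 2, 1)],
  [(1, 1, 0), (8, 1, 0), (2, 3, 0), (4, 3, 0), (14, 1, 14), (13, 3, 3), (11, 1, 0), (7, 3, 1),
    (12, 2, 4)],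
  [(2, 1, 0), (4, 1, 0), (8, 1, 0), (1, 3, 0), (9, 2, 0), (7, 1, 7), (5, 2, 0), (11, 1, 11), (13,
    1, 0), (14, 3, 3), (3, 2, 1)],
  [(1, 1, 0), (2, 1, 0), (8, 1, 0), (3, 3, 0), (6, 4, 0), (11, 1, 11), (10, 3, 2), (4, 2, 0), (9,
    1, 5), (13, 2, 1)],
  [(1, 1, 0), (4, 1, 0), (8, 1, 0), (9, 1, 0), (2, 2, 0), (13, 1, 0), (10, 4, 13), (5, 1, 0), (14,
    2, 3), (12, 1, 0), (11, 2, 5), (7, 2, 1)],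
  [(1, 5, 0), (2, 3, 0), (4, 3, 0), (7, 1, 0), (8, 2, 0), (9, 1, 0), (10, 1, 12), (12, 1, 6), (14,
    2, 3), (15, 1, 1)],
  [(1, 5, 0), (2, 2, 0), (3, 1, 0), (4, 2, 0), (5, 1, 0), (7, 1, 0), (8, 2, 0), (9, 1, 0), (11, 1,
    12), (13, 1, 6), (14, 2, 3), (15, 1, 1)],
  [(1, 6, 0), (2, 3, 0), (4, 3, 0), (6, 1, 0), (8, 3, 0), (10, 1, 12), (12, 1, 6), (14, 1, 3),
    (15, 2, 1)],
  [(1, 6, 0), (2, 3, 0), (4, 2, 0), (5, 1, 0), (7, 1, 0), (8, 2, 0), (9, 1, 0), (11, 1, 12), (12,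
    1, 6), (14, 1, 3), (15, 2, 1)],
  [(1, 4, 0), (2, 4, 3), (4, 4, 5), (8, 4, 9), (15, 4, 1)],
  [(1, 4, 0), (2, 4, 0), (4, 4, 6), (8, 2, 0), (9, 2, 10), (14, 2, 3), (15, 2, 1)],
  [(1, 4, 0), (2, 3, 0), (3, 1, 0), (4, 3, 0), (5, 1, 6), (8, 3, 0), (9, 1, 10), (14, 3, 3), (15,
    1, 1)],
  [(1, 4, 0), (2, 2, 0), (3, 2, 0), (4, 2, 0), (5, 2, 6), (8, 2, 0), (9, 2, 10), (14, 2, 3), (15,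
    2, 1)],
  [(2, 2, 0), (1, 2, 0), (5, 2, 0), (8, 2, 11), (4, 2, 0), (10, 2, 7), (14, 2, 0), (3, 2, 2), (13,
    2, 1)],
  [(1, 1, 0), (2, 1, 0), (8, 1, 0), (11, 3, 0), (6, 2, 0), (4, 2, 15), (3, 3, 0), (9, 1, 5), (10,
    1, 0), (15, 2, 2), (5, 2, 1)],
  [(1, 4, 0), (2, 4, 0), (4, 2, 0), (7, 2, 0), (8, 2, 10), (10, 2, 6), (14, 2, 3), (15, 2, 1)],
  [(8, 1, 0), (1, 4, 0), (2, 4, 0), (4, 4, 0), (9, 1, 0), (10, 1, 0), (11, 1, 12), (12, 1, 0),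
    (13, 1, 6), (14, 1, 3), (15, 1, 1)],
  [(1, 4, 0), (2, 3, 0), (3, 1, 0), (4, 3, 0), (5, 1, 0), (8, 2, 0), (10, 1, 0), (11, 1, 12), (12,
    1, 7), (13, 1, 1), (14, 2, 2)],
  [(1, 4, 0), (2, 2, 0), (3, 2, 0), (4, 2, 0), (6, 2, 0), (8, 2, 10), (10, 2, 6), (14, 2, 3), (15,
    2, 1)],
  [(8, 1, 0), (1, 4, 0), (2, 2, 0), (3, 2, 0), (4, 2, 0), (5, 2, 0), (9, 1, 0), (10, 1, 0), (11,
    1, 12), (12, 1, 0), (13, 1, 6), (14, 1, 3), (15, 1, 1)],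
  [(1, 5, 0), (2, 4, 0), (4, 3, 0), (5, 1, 0), (8, 2, 0), (10, 1, 0), (11, 1, 12), (12, 2, 6),
    (14, 1, 3), (15, 1, 1)],
  [(1, 5, 0), (2, 3, 0), (3, 1, 0), (4, 2, 0), (7, 2, 0), (8, 2, 0), (9, 2, 12), (12, 1, 0), (13,
    1, 6), (14, 1, 3), (15, 1, 1)],
  [(1, 3, 0), (2, 3, 0), (3, 2, 0), (4, 2, 0), (5, 1, 0), (6, 1, 0), (8, 2, 0), (9, 1, 0), (10, 1,
    12), (12, 2, 7), (13, 1, 1), (14, 1, 2)],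
  [(1, 3, 0), (2, 3, 0), (3, 2, 0), (4, 3, 0), (7, 1, 0), (8, 3, 0), (11, 1, 12), (12, 2, 7), (13,
    1, 1), (14, 1, 2)],
  [(1, 4, 0), (2, 4, 0), (3, 1, 0), (4, 3, 0), (7, 1, 0), (8, 2, 0), (9, 1, 0), (10, 1, 12), (12,
    2, 7), (13, 1, 1), (14, 1, 2)],
  [(1, 4, 0), (2, 4, 3), (3, 1, 0), (4, 3, 0), (7, 1, 0), (8, 3, 0), (11, 1, 12), (12, 3, 5), (15,
    1, 1)],
  [(1, 4, 0), (2, 3, 0), (3, 2, 0), (4, 3, 0), (6, 1, 0), (8, 3, 0), (10, 1, 12), (12, 1, 7), (13,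
    2, 1), (14, 1, 2)],
  [(1, 4, 0), (2, 3, 0), (3, 2, 0), (4, 2, 0), (5, 1, 0), (7, 1, 0), (8, 2, 0), (9, 1, 0), (11, 1,
    12), (12, 1, 7), (13, 2, 1), (14, 1, 2)],
  [(1, 3, 0), (2, 3, 0), (3, 3, 0), (4, 2, 0), (5, 2, 0), (8, 2, 0), (9, 2, 12), (12, 1, 0), (13,
    1, 6), (14, 1, 3), (15, 1, 1)],
  [(4, 1, 0), (8, 1, 0), (1, 3, 0), (2, 3, 0), (3, 3, 0), (5, 1, 0), (6, 1, 0), (7, 1, 0), (9, 1,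
    0), (10, 1, 0), (11, 1, 12), (12, 1, 0), (13, 1, 6), (14, 1, 3), (15, 1, 1)],
  [(1, 2, 0), (2, 2, 0), (4, 2, 0), (5, 2, 0), (6, 2, 0), (7, 2, 0), (8, 2, 14), (10, 2, 2), (12,
    2, 5), (13, 2, 1)],
  [(1, 3, 0), (2, 3, 0), (3, 1, 0), (4, 3, 0), (5, 1, 0), (6, 1, 0), (7, 1, 0), (8, 2, 10), (10,
    2, 7), (11, 2, 1), (14, 2, 2)],
  [(1, 3, 0), (2, 2, 0), (3, 2, 0), (4, 2, 0), (5, 2, 0), (6, 1, 0), (7, 1, 0), (8, 2, 0), (9, 2,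
    14), (10, 1, 0), (11, 1, 2), (12, 1, 5), (13, 1, 1)]]

/-- Representatives of the admissible multisets of dimension `5`. -/
def tables5 : List Table := [
  [(1, 1, 0), (2, 1, 0), (4, 1, 0), (8, 1, 0), (16, 1, 0), (7, 1, 0), (11, 1, 0), (13, 1, 0), (14,
    1, 15), (19, 1, 0), (21, 1, 0), (22, 1, 23), (25, 1, 0), (26, 1, 3), (28, 1, 5), (31, 1, 1)],
  [(1, 1, 0), (2, 1, 0), (4, 1, 0), (8, 1, 0), (16, 1, 0), (29, 1, 0), (5, 1, 0), (15, 1, 0), (9,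
    1, 30), (19, 2, 0), (31, 1, 1), (6, 1, 0), (24, 1, 10), (10, 1, 0), (20, 1, 6), (30, 1, 2)],
  [(2, 1, 0), (4, 1, 0), (8, 1, 0), (16, 1, 0), (29, 1, 0), (1, 3, 0), (10, 1, 23), (14, 1, 0),
    (23, 1, 0), (26, 1, 9), (18, 1, 0), (20, 1, 0), (13, 1, 6), (6, 1, 0), (31, 1, 2), (25, 1, 1)],
  [(1, 1, 0), (2, 1, 0), (4, 1, 0), (8, 1, 0), (16, 1, 0), (22, 4, 0), (11, 1, 11), (7, 1, 0),
    (13, 1, 0), (14, 1, 4), (26, 1, 0), (25, 1, 0), (19, 1, 16), (3, 1, 0), (9, 1, 1), (10, 1, 2)],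
  [(2, 1, 0), (4, 1, 0), (8, 1, 0), (16, 1, 0), (1, 5, 0), (6, 1, 0), (11, 1, 0), (12, 1, 0), (14,
    1, 0), (19, 1, 0), (20, 1, 0), (22, 1, 24), (25, 1, 1), (26, 1, 12), (28, 1, 6), (30, 1, 2)],
  [(2, 1, 0), (4, 1, 0), (8, 1, 0), (16, 1, 0), (1, 6, 0), (7, 1, 0), (11, 1, 0), (12, 1, 0), (14,
    1, 0), (18, 1, 0), (20, 1, 0), (23, 1, 24), (25, 1, 5), (26, 1, 9), (29, 1, 3), (31, 1, 1)],
  [(1, 1, 0), (2, 1, 0), (4, 1, 0), (8, 1, 0), (22, 2, 0), (16, 2, 0), (11, 1, 0), (14, 1, 30),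
    (21, 2, 11), (13, 1, 0), (7, 1, 4), (25, 2, 1), (10, 2, 2)],
  [(1, 4, 0), (2, 2, 0), (4, 2, 7), (8, 2, 0), (14, 2, 9), (16, 2, 0), (22, 2, 17), (27, 2, 2),
    (29, 2, 1)],
  [(16, 1, 0), (1, 4, 0), (2, 2, 0), (4, 2, 0), (8, 2, 0), (14, 2, 14), (17, 1, 0), (22, 1, 0),
    (23, 1, 22), (26, 1, 0), (27, 1, 2), (28, 1, 5), (29, 1, 1)],
  [(2, 1, 0), (4, 1, 0), (8, 1, 0), (16, 1, 0), (1, 4, 0), (3, 1, 0), (5, 1, 0), (9, 1, 0), (14,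
    1, 0), (15, 1, 14), (17, 1, 0), (22, 1, 0), (23, 1, 22), (26, 1, 0), (27, 1, 2), (28, 1, 5),
    (29, 1, 1)],
  [(1, 1, 0), (2, 1, 0), (4, 1, 0), (8, 1, 0), (16, 1, 0), (3, 1, 0), (31, 1, 0), (5, 1, 0), (18,
    2, 25), (11, 2, 6), (15, 1, 0), (24, 1, 0), (6, 1, 11), (23, 1, 1), (30, 2, 2)],
  [(1, 1, 0), (2, 1, 0), (4, 1, 0), (8, 1, 0), (16, 1, 0), (31, 3, 31), (6, 1, 0), (27, 1, 0), (5,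
    1, 0), (12, 1, 0), (20, 1, 4), (17, 2, 1), (24, 2, 8), (18, 2, 2)],
  [(1, 1, 0), (2, 1, 0), (4, 1, 0), (16, 1, 0), (8, 3, 0), (30, 1, 0), (12, 1, 0), (18, 1, 0),
    (24, 1, 0), (3, 1, 9), (31, 1, 22), (27, 1, 0), (15, 1, 0), (9, 1, 7), (6, 1, 2), (29, 2, 1)],
  [(16, 1, 0), (1, 4, 0), (2, 2, 0), (4, 2, 0), (8, 2, 0), (14, 2, 9), (18, 1, 0), (20, 1, 0),
    (22, 1, 17), (25, 1, 0), (27, 1, 5), (29, 1, 3), (31, 1, 1)],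
  [(2, 1, 0), (4, 1, 0), (8, 1, 0), (16, 1, 0), (1, 4, 0), (6, 1, 0), (7, 1, 0), (10, 1, 0), (11,
    1, 0), (14, 1, 0), (20, 1, 0), (21, 1, 0), (22, 1, 24), (24, 1, 15), (25, 1, 1), (26, 1, 2),
    (28, 1, 4)],
  [(8, 1, 0), (16, 1, 0), (1, 4, 0), (2, 2, 0), (4, 2, 0), (10, 1, 0), (12, 1, 0), (14, 1, 0),
    (19, 1, 0), (21, 1, 6), (22, 1, 24), (24, 1, 0), (25, 1, 10), (30, 1, 3), (31, 1, 1)],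
  [(16, 1, 0), (1, 5, 0), (2, 2, 0), (4, 2, 0), (8, 2, 0), (14, 1, 0), (15, 1, 0), (18, 1, 0),
    (20, 1, 0), (23, 1, 24), (25, 1, 1), (26, 1, 12), (28, 1, 6), (30, 1, 2)],
  [(4, 1, 0), (8, 1, 0), (16, 1, 0), (1, 5, 0), (2, 2, 0), (7, 1, 0), (11, 1, 0), (12, 1, 0), (13,
    1, 0), (19, 1, 0), (20, 1, 0), (21, 1, 24), (26, 1, 7), (27, 1, 11), (29, 1, 1), (30, 1, 2)],
  [(2, 1, 0), (4, 1, 0), (8, 1, 0), (10, 1, 0), (3, 2, 0), (12, 1, 0), (16, 2, 0), (14, 1, 30),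
    (20, 2, 6), (1, 2, 9), (6, 1, 0), (25, 2, 3), (31, 2, 1)],
  [(1, 1, 0), (2, 1, 0), (4, 1, 0), (8, 1, 0), (16, 1, 0), (21, 2, 0), (7, 1, 0), (6, 1, 0), (5,
    2, 0), (14, 1, 9), (29, 1, 21), (27, 1, 6), (22, 1, 0), (15, 2, 2), (25, 2, 1)],
  [(16, 1, 0), (1, 3, 0), (2, 3, 0), (4, 2, 0), (8, 2, 0), (13, 1, 0), (14, 1, 0), (18, 1, 0),
    (22, 1, 0), (23, 1, 24), (24, 1, 9), (25, 1, 5), (29, 1, 3), (31, 1, 1)],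
  [(1, 3, 0), (2, 3, 0), (4, 2, 0), (8, 2, 0), (12, 1, 0), (15, 1, 0), (16, 2, 23), (20, 1, 0),
    (23, 1, 15), (25, 1, 5), (26, 1, 3), (31, 2, 1)],
  [(16, 1, 0), (1, 3, 0), (2, 2, 0), (3, 1, 0), (4, 2, 0), (8, 2, 0), (12, 1, 0), (14, 1, 0), (19,
    1, 0), (22, 1, 0), (23, 1, 24), (24, 1, 15), (25, 1, 3), (28, 1, 5), (31, 1, 1)],
  [(1, 3, 0), (2, 2, 0), (3, 1, 0), (4, 2, 0), (8, 2, 0), (13, 1, 0), (15, 1, 0), (16, 2, 29),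
    (20, 1, 0), (22, 1, 5), (24, 1, 10), (26, 1, 3), (31, 2, 1)],
  [(4, 1, 0), (8, 1, 0), (16, 1, 0), (1, 3, 0), (2, 2, 0), (3, 1, 0), (6, 1, 0), (10, 1, 0), (12,
    1, 0), (14, 1, 0), (17, 1, 26), (22, 1, 0), (23, 1, 2), (24, 1, 0), (25, 1, 12), (28, 1, 5),
    (29, 1, 1)],
  [(1, 4, 0), (2, 3, 0), (4, 2, 0), (8, 2, 0), (13, 1, 0), (15, 1, 0), (16, 2, 21), (20, 1, 0),
    (22, 1, 13), (25, 1, 7), (27, 1, 1), (30, 2, 2)],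
  [(16, 1, 0), (1, 4, 0), (2, 3, 0), (4, 2, 0), (8, 2, 0), (12, 1, 0), (14, 1, 0), (19, 1, 0),
    (20, 1, 0), (21, 1, 24), (26, 1, 7), (27, 1, 11), (29, 1, 1), (30, 1, 2)],
  [(1, 4, 0), (2, 2, 0), (3, 1, 0), (4, 2, 0), (8, 2, 11), (13, 1, 0), (14, 1, 0), (16, 2, 0),
    (20, 1, 0), (23, 1, 19), (25, 1, 1), (26, 1, 6), (30, 2, 2)],
  [(16, 1, 0), (1, 4, 0), (2, 2, 0), (3, 1, 0), (4, 2, 0), (8, 2, 0), (13, 1, 0), (14, 1, 0), (18,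
    1, 0), (20, 1, 0), (21, 1, 24), (26, 1, 13), (27, 1, 1), (28, 1, 6), (30, 1, 2)],
  [(4, 1, 0), (8, 1, 0), (16, 1, 0), (1, 4, 0), (2, 2, 0), (3, 1, 0), (7, 1, 0), (11, 1, 0), (13,
    1, 0), (14, 1, 0), (17, 1, 26), (22, 1, 0), (23, 1, 2), (24, 1, 0), (25, 1, 12), (28, 1, 5),
    (29, 1, 1)],
  [(1, 2, 0), (2, 2, 0), (4, 2, 0), (7, 2, 0), (8, 2, 0), (15, 2, 14), (16, 2, 20), (22, 2, 2),
    (28, 2, 5), (29, 2, 1)],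
  [(1, 1, 0), (2, 1, 0), (4, 1, 0), (8, 1, 0), (16, 2, 0), (19, 2, 0), (3, 2, 0), (26, 2, 0), (15,
    2, 0), (21, 2, 16), (7, 1, 7), (13, 1, 10), (11, 1, 1), (14, 1, 2)],
  [(1, 3, 0), (2, 2, 0), (4, 2, 0), (6, 1, 0), (7, 1, 0), (8, 2, 0), (14, 2, 14), (16, 2, 0), (17,
    2, 22), (26, 1, 0), (27, 1, 2), (28, 1, 5), (29, 1, 1)],
  [(16, 1, 0), (1, 3, 0), (2, 3, 0), (3, 1, 0), (4, 2, 0), (8, 2, 0), (14, 2, 0), (17, 1, 22),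
    (20, 1, 0), (21, 1, 14), (26, 1, 0), (27, 1, 2), (28, 1, 5), (29, 1, 1)],
  [(4, 1, 0), (8, 1, 0), (16, 1, 0), (1, 3, 0), (2, 2, 0), (3, 2, 0), (5, 1, 0), (9, 1, 14), (12,
    1, 0), (13, 1, 0), (17, 1, 0), (22, 1, 0), (23, 1, 22), (26, 1, 0), (27, 1, 2), (28, 1, 5),
    (29, 1, 1)],
  [(1, 1, 0), (2, 1, 0), (4, 1, 0), (8, 1, 0), (16, 1, 0), (20, 2, 0), (26, 2, 0), (3, 2, 0), (23,
    2, 0), (31, 1, 31), (24, 1, 0), (18, 1, 10), (10, 1, 7), (5, 1, 0), (27, 1, 1), (30, 1, 2)],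
  [(8, 1, 0), (16, 1, 0), (1, 3, 0), (2, 3, 0), (3, 1, 0), (4, 2, 0), (10, 1, 0), (12, 1, 0), (14,
    1, 0), (19, 1, 0), (21, 1, 18), (22, 1, 10), (26, 1, 0), (27, 1, 6), (30, 1, 3), (31, 1, 1)],
  [(4, 1, 0), (8, 1, 0), (16, 1, 0), (1, 3, 0), (2, 2, 0), (3, 2, 0), (6, 1, 0), (10, 1, 0), (12,
    1, 0), (13, 1, 0), (18, 1, 0), (22, 1, 0), (23, 1, 24), (26, 1, 13), (27, 1, 1), (28, 1, 6),
    (30, 1, 2)],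
  [(16, 1, 0), (1, 3, 0), (2, 2, 0), (3, 2, 0), (4, 2, 0), (8, 2, 0), (12, 1, 0), (13, 1, 0), (18,
    1, 0), (21, 1, 0), (22, 1, 24), (25, 1, 1), (26, 1, 12), (28, 1, 6), (30, 1, 2)],
  [(16, 1, 0), (1, 3, 0), (2, 3, 0), (3, 1, 0), (4, 2, 0), (8, 2, 0), (12, 2, 0), (19, 1, 23),
    (20, 1, 0), (23, 1, 15), (25, 1, 0), (26, 1, 3), (28, 1, 5), (31, 1, 1)],
  [(1, 1, 0), (4, 1, 0), (8, 1, 0), (16, 1, 0), (3, 2, 0), (2, 2, 0), (18, 2, 0), (10, 2, 0), (30,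
    2, 0), (25, 1, 27), (28, 1, 5), (13, 1, 8), (7, 2, 2), (21, 1, 1)],
  [(1, 3, 0), (2, 3, 0), (4, 3, 0), (8, 3, 0), (15, 1, 0), (16, 3, 0), (23, 1, 24), (27, 1, 12),
    (29, 1, 6), (30, 1, 3), (31, 1, 1)],
  [(1, 3, 0), (2, 3, 0), (4, 3, 0), (8, 2, 0), (9, 1, 0), (14, 1, 0), (16, 2, 0), (17, 1, 0), (22,
    1, 24), (27, 1, 12), (29, 1, 6), (30, 1, 3), (31, 1, 1)],
  [(1, 3, 0), (2, 2, 0), (3, 1, 0), (4, 2, 0), (5, 1, 0), (8, 2, 0), (9, 1, 0), (14, 1, 0), (16,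
    2, 0), (17, 1, 0), (22, 1, 24), (26, 1, 12), (28, 1, 6), (30, 1, 3), (31, 1, 1)],
  [(1, 1, 0), (2, 1, 0), (4, 1, 0), (8, 1, 0), (16, 1, 0), (14, 2, 0), (5, 2, 0), (21, 2, 0), (23,
    2, 0), (10, 1, 0), (11, 1, 11), (29, 1, 23), (3, 1, 2), (25, 1, 0), (13, 1, 1), (20, 1, 4)],
  [(1, 1, 0), (4, 1, 0), (8, 1, 0), (16, 1, 0), (15, 2, 0), (24, 2, 0), (10, 2, 0), (17, 2, 0),
    (14, 2, 0), (2, 2, 2), (21, 1, 21), (28, 1, 9), (25, 1, 5), (13, 1, 1)],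
  [(1, 3, 0), (2, 3, 0), (4, 2, 0), (7, 1, 0), (8, 2, 0), (10, 1, 0), (14, 1, 0), (16, 2, 0), (17,
    1, 0), (21, 1, 24), (24, 1, 12), (29, 1, 6), (30, 1, 3), (31, 1, 1)],
  [(8, 1, 0), (16, 1, 0), (1, 3, 0), (2, 3, 0), (4, 3, 0), (10, 1, 0), (11, 1, 0), (14, 1, 0),
    (18, 1, 0), (19, 1, 0), (22, 1, 24), (27, 1, 12), (29, 1, 6), (30, 1, 3), (31, 1, 1)],
  [(1, 3, 0), (2, 2, 0), (3, 1, 0), (4, 2, 0), (6, 1, 0), (8, 2, 0), (10, 1, 0), (14, 1, 0), (16,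
    2, 0), (17, 1, 0), (21, 1, 24), (25, 1, 12), (28, 1, 6), (30, 1, 3), (31, 1, 1)],
  [(8, 1, 0), (16, 1, 0), (1, 3, 0), (2, 2, 0), (3, 1, 0), (4, 2, 0), (5, 1, 0), (10, 1, 0), (11,
    1, 0), (14, 1, 0), (18, 1, 0), (19, 1, 0), (22, 1, 24), (26, 1, 12), (28, 1, 6), (30, 1, 3),
    (31, 1, 1)],
  [(16, 1, 0), (1, 2, 0), (2, 2, 0), (3, 1, 0), (4, 2, 0), (5, 2, 0), (8, 2, 0), (9, 1, 0), (10,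
    1, 0), (18, 1, 0), (22, 1, 0), (23, 1, 24), (24, 1, 14), (26, 1, 2), (28, 1, 5), (29, 1, 1)],
  [(1, 2, 0), (2, 2, 0), (3, 1, 0), (4, 2, 0), (8, 2, 0), (9, 2, 0), (12, 1, 0), (15, 1, 0), (16,
    2, 19), (17, 1, 0), (18, 1, 7), (22, 2, 11), (29, 1, 1), (30, 1, 2)],
  [(4, 1, 0), (8, 1, 0), (16, 1, 0), (1, 2, 0), (2, 2, 0), (3, 2, 0), (6, 1, 0), (7, 1, 0), (9, 1,
    0), (10, 1, 0), (14, 1, 0), (18, 1, 0), (19, 1, 0), (20, 1, 24), (26, 1, 12), (28, 1, 7), (29,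
    1, 1), (30, 1, 2)],
  [(1, 3, 0), (2, 2, 0), (4, 2, 0), (6, 1, 0), (7, 1, 0), (8, 2, 0), (10, 2, 0), (16, 2, 22), (21,
    2, 14), (26, 1, 0), (27, 1, 2), (28, 1, 5), (29, 1, 1)],
  [(16, 1, 0), (1, 3, 0), (2, 2, 0), (4, 2, 0), (6, 1, 0), (7, 1, 0), (8, 2, 0), (14, 2, 0), (17,
    1, 18), (18, 1, 0), (19, 1, 10), (26, 1, 0), (27, 1, 6), (30, 1, 3), (31, 1, 1)],
  [(2, 1, 0), (4, 1, 0), (8, 1, 0), (16, 1, 0), (1, 3, 0), (3, 1, 0), (5, 1, 0), (6, 1, 0), (7, 1,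
    0), (9, 1, 0), (10, 1, 0), (11, 1, 0), (17, 1, 22), (20, 1, 0), (21, 1, 14), (26, 1, 0), (27,
    1, 2), (28, 1, 5), (29, 1, 1)],
  [(1, 2, 0), (2, 2, 0), (3, 1, 0), (4, 2, 0), (6, 1, 0), (7, 1, 0), (8, 2, 0), (9, 1, 0), (11, 1,
    0), (16, 2, 0), (20, 1, 0), (22, 1, 24), (24, 1, 15), (25, 1, 3), (28, 1, 5), (31, 1, 1)],
  [(8, 1, 0), (16, 1, 0), (1, 2, 0), (2, 2, 0), (3, 1, 0), (4, 2, 0), (5, 1, 0), (6, 1, 0), (10,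
    1, 0), (12, 1, 0), (14, 1, 0), (17, 1, 28), (20, 1, 0), (21, 1, 4), (24, 1, 0), (25, 1, 10),
    (26, 1, 3), (27, 1, 1)]]

/-- Representatives of the admissible multisets of dimension `6`. -/
def tables6 : List Table := [
  [(1, 1, 0), (2, 1, 0), (4, 1, 0), (8, 1, 0), (16, 1, 0), (32, 1, 0), (29, 2, 0), (41, 1, 0),
    (62, 1, 62), (55, 1, 0), (19, 1, 0), (11, 1, 21), (7, 1, 10), (59, 1, 0), (37, 1, 6), (49, 1,
    3), (47, 1, 1)],
  [(2, 1, 0), (4, 1, 0), (8, 1, 0), (16, 1, 0), (32, 1, 0), (1, 4, 0), (14, 1, 15), (22, 1, 0),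
    (26, 1, 0), (28, 1, 17), (38, 1, 0), (42, 1, 0), (44, 1, 33), (51, 1, 0), (53, 1, 6), (57, 1,
    3), (63, 1, 1)],
  [(1, 1, 0), (2, 1, 0), (4, 1, 0), (8, 1, 0), (16, 1, 0), (32, 1, 0), (52, 1, 0), (51, 1, 0),
    (17, 1, 0), (61, 1, 43), (43, 1, 0), (7, 1, 31), (29, 1, 0), (10, 1, 6), (47, 1, 1), (38, 1,
    0), (30, 1, 2), (56, 1, 8)],
  [(1, 1, 0), (2, 1, 0), (4, 1, 0), (8, 1, 0), (16, 1, 0), (32, 1, 0), (25, 1, 0), (3, 1, 0), (29,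
    1, 0), (56, 2, 0), (63, 1, 37), (10, 1, 23), (13, 1, 10), (46, 2, 3), (43, 1, 0), (52, 1, 5),
    (31, 1, 1)],
  [(1, 1, 0), (2, 1, 0), (4, 1, 0), (8, 1, 0), (16, 1, 0), (32, 1, 0), (33, 1, 0), (23, 1, 0),
    (47, 2, 0), (29, 1, 60), (21, 1, 0), (3, 1, 0), (63, 1, 11), (25, 1, 18), (36, 1, 4), (26, 1,
    0), (51, 1, 2), (41, 1, 1)],
  [(2, 1, 0), (4, 1, 0), (8, 1, 0), (16, 1, 0), (32, 1, 0), (1, 3, 0), (10, 1, 0), (12, 1, 0),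
    (18, 1, 0), (21, 1, 0), (30, 1, 0), (38, 1, 0), (39, 1, 45), (40, 1, 29), (49, 1, 5), (58, 1,
    9), (61, 1, 3), (63, 1, 1)],
  [(4, 1, 0), (8, 1, 0), (16, 1, 0), (32, 1, 0), (1, 3, 0), (2, 2, 0), (15, 1, 0), (20, 1, 0),
    (24, 1, 0), (30, 1, 0), (36, 1, 0), (41, 1, 21), (47, 1, 37), (51, 1, 14), (54, 1, 3), (59, 1,
    1), (60, 1, 4)],
  [(4, 1, 0), (8, 1, 0), (16, 1, 0), (32, 1, 0), (1, 4, 0), (2, 2, 0), (14, 1, 0), (20, 1, 0),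
    (25, 1, 0), (31, 1, 0), (36, 1, 49), (41, 1, 0), (47, 1, 1), (50, 1, 14), (54, 1, 22), (58, 1,
    2), (60, 1, 4)],
  [(2, 1, 0), (4, 1, 0), (8, 1, 0), (16, 1, 0), (32, 1, 0), (1, 4, 0), (10, 1, 0), (12, 1, 0),
    (18, 1, 0), (20, 1, 0), (30, 1, 0), (38, 1, 39), (39, 1, 0), (41, 1, 23), (49, 1, 15), (58, 1,
    3), (60, 1, 5), (63, 1, 1)],
  [(1, 1, 0), (2, 1, 0), (4, 1, 0), (8, 1, 0), (16, 1, 0), (32, 1, 0), (5, 1, 0), (23, 1, 0), (58,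
    2, 0), (26, 2, 0), (17, 1, 20), (60, 1, 45), (52, 1, 0), (9, 1, 7), (61, 1, 8), (21, 1, 0),
    (54, 1, 3), (35, 1, 1)],
  [(4, 1, 0), (8, 1, 0), (16, 1, 0), (32, 1, 0), (1, 3, 0), (2, 3, 0), (13, 1, 0), (20, 1, 0),
    (26, 1, 0), (28, 1, 0), (36, 1, 0), (41, 1, 5), (47, 1, 48), (50, 1, 10), (53, 1, 18), (58, 1,
    3), (63, 1, 1)],
  [(4, 1, 0), (8, 1, 0), (16, 1, 0), (32, 1, 0), (1, 3, 0), (2, 2, 0), (3, 1, 0), (12, 1, 0), (21,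
    1, 0), (27, 1, 0), (28, 1, 0), (36, 1, 0), (40, 1, 29), (46, 1, 45), (51, 1, 10), (52, 1, 5),
    (58, 1, 3), (63, 1, 1)],
  [(4, 1, 0), (8, 1, 0), (16, 1, 0), (32, 1, 0), (1, 2, 0), (2, 2, 0), (3, 2, 0), (13, 1, 0), (23,
    1, 0), (26, 1, 0), (28, 1, 0), (37, 1, 0), (40, 1, 30), (44, 1, 46), (50, 1, 3), (52, 1, 5),
    (56, 1, 9), (63, 1, 1)],
  [(1, 1, 0), (2, 1, 0), (4, 1, 0), (32, 1, 0), (8, 2, 0), (16, 2, 0), (14, 2, 0), (27, 2, 0),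
    (49, 2, 24), (60, 2, 8), (7, 1, 7), (38, 1, 33), (35, 1, 2), (37, 1, 1)],
  [(1, 1, 0), (2, 1, 0), (4, 1, 0), (8, 1, 0), (16, 1, 0), (32, 1, 0), (11, 2, 0), (23, 2, 0),
    (25, 2, 0), (53, 2, 0), (52, 1, 52), (56, 1, 12), (50, 1, 6), (49, 1, 3), (47, 1, 17), (31, 1,
    1)],
  [(1, 1, 0), (2, 1, 0), (4, 1, 0), (8, 1, 0), (16, 1, 0), (32, 1, 0), (5, 2, 0), (18, 2, 0), (28,
    1, 0), (13, 1, 0), (14, 1, 31), (59, 1, 41), (37, 1, 0), (62, 1, 4), (49, 1, 0), (42, 1, 3),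
    (56, 1, 8), (35, 1, 1)],
  [(32, 1, 0), (1, 3, 0), (2, 2, 0), (4, 2, 0), (8, 2, 0), (16, 2, 30), (30, 1, 0), (31, 1, 0),
    (38, 1, 0), (43, 1, 0), (44, 1, 46), (51, 1, 9), (52, 1, 6), (57, 1, 3), (63, 1, 1)],
  [(8, 1, 0), (16, 1, 0), (32, 1, 0), (1, 3, 0), (2, 2, 0), (4, 2, 0), (14, 1, 0), (22, 1, 0),
    (28, 1, 0), (29, 1, 0), (38, 1, 54), (42, 1, 0), (43, 1, 6), (48, 1, 17), (49, 1, 9), (57, 1,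
    3), (63, 1, 1)],
  [(2, 1, 0), (4, 1, 0), (8, 1, 0), (16, 1, 0), (32, 1, 0), (1, 3, 0), (14, 1, 0), (20, 1, 0),
    (21, 1, 0), (22, 1, 0), (26, 1, 0), (28, 1, 30), (33, 1, 38), (42, 1, 0), (43, 1, 12), (44, 1,
    0), (45, 1, 4), (50, 1, 3), (51, 1, 1)],
  [(1, 1, 0), (2, 1, 0), (4, 1, 0), (8, 1, 0), (16, 1, 0), (32, 1, 0), (45, 2, 0), (36, 2, 0),
    (21, 2, 0), (22, 1, 22), (14, 1, 14), (27, 1, 0), (58, 1, 33), (6, 1, 5), (39, 1, 0), (26, 1,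
    2), (61, 1, 1)],
  [(1, 1, 0), (2, 1, 0), (4, 1, 0), (8, 1, 0), (16, 1, 0), (32, 2, 0), (46, 2, 0), (37, 2, 0),
    (58, 2, 32), (18, 1, 0), (19, 1, 19), (29, 1, 15), (3, 1, 2), (21, 1, 0), (12, 1, 4), (25, 1,
    1)],
  [(1, 1, 0), (2, 1, 0), (4, 1, 0), (8, 1, 0), (16, 1, 0), (32, 1, 0), (57, 2, 0), (34, 2, 0),
    (17, 1, 0), (15, 1, 30), (7, 1, 0), (62, 1, 39), (50, 1, 0), (44, 1, 7), (24, 1, 0), (13, 1,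
    8), (21, 1, 1), (6, 1, 2)],
  [(1, 1, 0), (2, 1, 0), (4, 1, 0), (8, 1, 0), (16, 1, 0), (32, 1, 0), (10, 2, 0), (17, 1, 0),
    (12, 1, 0), (60, 1, 0), (61, 1, 61), (5, 1, 0), (42, 1, 3), (47, 1, 8), (19, 1, 0), (20, 1,
    0), (55, 1, 4), (35, 1, 1), (48, 1, 16)],
  [(16, 1, 0), (32, 1, 0), (1, 3, 0), (2, 2, 0), (4, 2, 0), (8, 2, 0), (23, 1, 0), (25, 1, 0),
    (31, 1, 0), (36, 1, 0), (42, 1, 12), (47, 1, 48), (48, 1, 23), (50, 1, 3), (60, 1, 5), (63, 1,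
    1)],
  [(8, 1, 0), (16, 1, 0), (32, 1, 0), (1, 3, 0), (2, 2, 0), (4, 2, 0), (14, 1, 0), (20, 1, 0),
    (24, 1, 0), (27, 1, 0), (35, 1, 0), (40, 1, 54), (44, 1, 6), (49, 1, 18), (55, 1, 10), (62, 1,
    3), (63, 1, 1)],
  [(4, 1, 0), (8, 1, 0), (16, 1, 0), (32, 1, 0), (1, 3, 0), (2, 2, 0), (12, 1, 0), (14, 1, 0),
    (19, 1, 0), (21, 1, 0), (25, 1, 0), (40, 1, 0), (41, 1, 26), (46, 1, 42), (50, 1, 14), (54, 1,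
    3), (55, 1, 1), (60, 1, 4)],
  [(2, 1, 0), (4, 1, 0), (8, 1, 0), (16, 1, 0), (32, 1, 0), (1, 3, 0), (6, 1, 0), (10, 1, 0), (12,
    1, 0), (22, 1, 0), (23, 1, 0), (30, 1, 0), (36, 1, 0), (37, 1, 12), (46, 1, 48), (49, 1, 20),
    (60, 1, 5), (61, 1, 3), (63, 1, 1)],
  [(32, 1, 0), (1, 2, 0), (2, 2, 0), (4, 2, 0), (8, 2, 0), (14, 1, 0), (16, 2, 29), (17, 1, 0),
    (31, 1, 0), (34, 1, 0), (39, 1, 0), (43, 1, 45), (52, 1, 5), (56, 1, 9), (61, 1, 3), (63, 1,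
    1)],
  [(8, 1, 0), (16, 1, 0), (32, 1, 0), (1, 2, 0), (2, 2, 0), (4, 2, 0), (5, 1, 0), (14, 1, 0), (18,
    1, 0), (26, 1, 0), (27, 1, 0), (37, 1, 0), (41, 1, 12), (47, 1, 48), (48, 1, 22), (50, 1, 2),
    (60, 1, 5), (61, 1, 1)],
  [(4, 1, 0), (8, 1, 0), (16, 1, 0), (32, 1, 0), (1, 2, 0), (2, 2, 0), (3, 1, 0), (18, 1, 0), (20,
    1, 0), (24, 1, 0), (30, 1, 0), (31, 1, 0), (47, 1, 48), (48, 1, 18), (54, 1, 0), (55, 1, 10),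
    (58, 1, 3), (59, 1, 5), (63, 1, 1)],
  [(16, 1, 0), (32, 1, 0), (1, 2, 0), (2, 2, 0), (4, 2, 0), (8, 2, 0), (9, 1, 0), (18, 1, 0), (22,
    1, 0), (29, 1, 0), (42, 1, 0), (44, 1, 22), (47, 1, 38), (50, 1, 7), (51, 1, 2), (53, 1, 9),
    (61, 1, 1)],
  [(4, 1, 0), (8, 1, 0), (16, 1, 0), (32, 1, 0), (1, 2, 0), (2, 2, 0), (3, 1, 0), (7, 1, 0), (12,
    1, 0), (18, 1, 0), (24, 1, 0), (30, 1, 0), (35, 1, 0), (40, 1, 34), (47, 1, 18), (54, 1, 5),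
    (55, 1, 10), (58, 1, 3), (63, 1, 1)],
  [(8, 1, 0), (16, 1, 0), (32, 1, 0), (1, 2, 0), (2, 2, 0), (3, 1, 0), (4, 2, 0), (11, 1, 0), (20,
    1, 0), (25, 1, 0), (29, 1, 0), (35, 1, 43), (44, 1, 10), (47, 1, 17), (49, 1, 0), (53, 1, 3),
    (59, 1, 5), (63, 1, 1)],
  [(16, 1, 0), (32, 1, 0), (1, 2, 0), (2, 2, 0), (4, 2, 0), (8, 2, 0), (14, 1, 0), (17, 1, 0),
    (18, 1, 0), (29, 1, 0), (36, 1, 0), (37, 1, 22), (47, 1, 38), (50, 1, 14), (58, 1, 7), (59, 1,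
    2), (61, 1, 1)],
  [(2, 1, 0), (4, 1, 0), (8, 1, 0), (16, 1, 0), (32, 1, 0), (1, 2, 0), (3, 1, 0), (6, 1, 0), (7,
    1, 0), (12, 1, 0), (20, 1, 0), (24, 1, 0), (28, 1, 18), (33, 1, 46), (40, 1, 0), (41, 1, 12),
    (50, 1, 0), (51, 1, 6), (62, 1, 3), (63, 1, 1)],
  [(1, 2, 0), (2, 2, 0), (4, 2, 0), (7, 1, 0), (8, 2, 0), (16, 2, 30), (25, 1, 0), (30, 1, 0),
    (32, 2, 45), (42, 1, 0), (45, 1, 3), (51, 1, 9), (52, 1, 5), (63, 2, 1)],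
  [(4, 1, 0), (8, 1, 0), (16, 1, 0), (32, 1, 0), (1, 2, 0), (2, 2, 0), (14, 1, 0), (20, 1, 0),
    (21, 1, 0), (22, 1, 0), (25, 1, 0), (28, 1, 0), (34, 1, 48), (50, 1, 0), (51, 1, 24), (57, 1,
    14), (59, 1, 2), (60, 1, 5), (61, 1, 1)],
  [(8, 1, 0), (16, 1, 0), (32, 1, 0), (1, 2, 0), (2, 2, 0), (4, 2, 0), (11, 1, 0), (14, 1, 0),
    (28, 1, 0), (30, 1, 0), (31, 1, 0), (40, 1, 0), (41, 1, 57), (44, 1, 9), (48, 1, 17), (57, 1,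
    3), (59, 1, 5), (63, 1, 1)],
  [(2, 1, 0), (4, 1, 0), (8, 1, 0), (16, 1, 0), (32, 1, 0), (1, 2, 0), (10, 1, 0), (11, 1, 0),
    (12, 1, 0), (14, 1, 0), (28, 1, 0), (30, 1, 0), (31, 1, 0), (42, 1, 0), (43, 1, 18), (44, 1,
    34), (50, 1, 3), (51, 1, 13), (55, 1, 4), (59, 1, 1)],
  [(1, 1, 0), (2, 1, 0), (4, 1, 0), (8, 1, 0), (16, 1, 0), (32, 1, 0), (6, 1, 0), (7, 1, 0), (10,
    1, 0), (20, 1, 0), (36, 1, 0), (40, 1, 0), (41, 1, 0), (46, 1, 0), (47, 1, 48), (48, 1, 20),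
    (52, 1, 5), (53, 1, 0), (55, 1, 9), (61, 1, 3), (63, 1, 1)],
  [(1, 1, 0), (2, 1, 0), (4, 1, 0), (8, 1, 0), (16, 1, 0), (32, 1, 0), (6, 1, 0), (10, 1, 0), (11,
    1, 0), (20, 1, 0), (22, 1, 0), (27, 1, 0), (28, 1, 0), (29, 1, 0), (40, 1, 34), (42, 1, 0),
    (43, 1, 22), (46, 1, 3), (47, 1, 4), (51, 1, 9), (59, 1, 1)]]

/-- Representatives of the admissible multisets of dimension `7`. -/
def tables7 : List Table := [
  [(1, 1, 0), (2, 1, 0), (4, 1, 0), (8, 1, 0), (16, 1, 0), (32, 1, 0), (64, 1, 0), (7, 1, 0), (88,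
    1, 95), (29, 1, 0), (109, 1, 0), (78, 1, 62), (59, 1, 0), (83, 1, 19), (118, 1, 10), (47, 1,
    0), (49, 1, 1), (122, 1, 2), (100, 1, 4)],
  [(1, 1, 0), (2, 1, 0), (4, 1, 0), (8, 1, 0), (16, 1, 0), (32, 1, 0), (64, 1, 0), (106, 2, 0),
    (89, 2, 0), (112, 1, 0), (11, 1, 123), (61, 1, 61), (7, 1, 12), (62, 1, 3), (124, 1, 0), (76,
    1, 5), (31, 1, 16), (47, 1, 1)],
  [(2, 1, 0), (4, 1, 0), (8, 1, 0), (16, 1, 0), (32, 1, 0), (64, 1, 0), (1, 3, 0), (15, 1, 0),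
    (23, 1, 0), (38, 1, 62), (58, 1, 0), (59, 1, 0), (74, 1, 0), (82, 1, 29), (95, 1, 67), (98, 1,
    7), (110, 1, 9), (118, 1, 2), (125, 1, 1)],
  [(1, 1, 0), (2, 1, 0), (4, 1, 0), (8, 1, 0), (16, 1, 0), (32, 1, 0), (64, 1, 0), (118, 2, 0),
    (107, 1, 0), (108, 1, 0), (59, 1, 59), (7, 1, 87), (55, 1, 0), (40, 1, 24), (57, 1, 5), (98,
    1, 2), (125, 1, 0), (37, 1, 1), (88, 1, 8)],
  [(2, 1, 0), (4, 1, 0), (8, 1, 0), (16, 1, 0), (32, 1, 0), (64, 1, 0), (1, 3, 0), (14, 1, 0),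
    (21, 1, 0), (34, 1, 0), (59, 1, 59), (61, 1, 0), (77, 1, 0), (86, 1, 90), (95, 1, 1), (102, 1,
    4), (104, 1, 10), (112, 1, 18), (122, 1, 2)],
  [(1, 1, 0), (2, 1, 0), (4, 1, 0), (8, 1, 0), (16, 1, 0), (32, 1, 0), (64, 1, 0), (67, 1, 0),
    (44, 1, 111), (117, 1, 0), (122, 1, 0), (31, 1, 60), (106, 1, 0), (91, 1, 0), (12, 1, 22),
    (124, 1, 8), (65, 1, 5), (39, 1, 0), (50, 1, 2), (21, 1, 1)],
  [(4, 1, 0), (8, 1, 0), (16, 1, 0), (32, 1, 0), (64, 1, 0), (1, 2, 0), (2, 2, 0), (12, 1, 0),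
    (23, 1, 0), (41, 1, 0), (53, 1, 0), (59, 1, 0), (70, 1, 70), (90, 1, 3), (91, 1, 37), (100, 1,
    20), (107, 1, 1), (116, 1, 12), (124, 1, 4)],
  [(2, 1, 0), (4, 1, 0), (8, 1, 0), (16, 1, 0), (32, 1, 0), (64, 1, 0), (1, 2, 0), (6, 1, 0), (20,
    1, 0), (26, 1, 0), (50, 1, 58), (59, 1, 0), (63, 1, 0), (87, 1, 92), (92, 1, 0), (93, 1, 6),
    (104, 1, 10), (112, 1, 17), (113, 1, 3), (127, 1, 1)],
  [(8, 1, 0), (16, 1, 0), (32, 1, 0), (64, 1, 0), (1, 2, 0), (2, 2, 0), (4, 2, 0), (25, 1, 0),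
    (42, 1, 0), (54, 1, 0), (61, 1, 0), (79, 1, 92), (81, 1, 18), (95, 1, 46), (101, 1, 1), (104,
    1, 12), (114, 1, 6), (126, 1, 2)],
  [(2, 1, 0), (4, 1, 0), (8, 1, 0), (16, 1, 0), (32, 1, 0), (64, 1, 0), (1, 2, 0), (6, 1, 0), (42,
    1, 0), (46, 1, 0), (50, 1, 0), (53, 1, 0), (59, 1, 0), (66, 1, 92), (73, 1, 30), (82, 1, 6),
    (94, 1, 3), (95, 1, 33), (103, 1, 9), (127, 1, 1)],
  [(4, 1, 0), (8, 1, 0), (16, 1, 0), (32, 1, 0), (64, 1, 0), (1, 2, 0), (2, 2, 0), (13, 1, 0),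
    (26, 1, 0), (47, 1, 0), (59, 1, 23), (63, 1, 0), (67, 1, 0), (84, 1, 46), (92, 1, 78), (101,
    1, 1), (104, 1, 8), (114, 1, 2), (116, 1, 4)],
  [(1, 1, 0), (2, 1, 0), (4, 1, 0), (8, 1, 0), (16, 1, 0), (32, 1, 0), (64, 1, 0), (10, 1, 0),
    (18, 1, 0), (34, 1, 0), (43, 1, 0), (47, 1, 0), (52, 1, 0), (53, 1, 0), (71, 1, 96), (104, 1,
    28), (108, 1, 44), (116, 1, 13), (117, 1, 4), (121, 1, 3), (123, 1, 1)],
  [(1, 1, 0), (2, 1, 0), (4, 1, 0), (8, 1, 0), (16, 1, 0), (32, 1, 0), (64, 1, 0), (12, 1, 0),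
    (28, 1, 0), (42, 1, 0), (43, 1, 0), (44, 1, 0), (53, 1, 0), (55, 1, 22), (72, 1, 0), (73, 1,
    10), (79, 1, 70), (90, 1, 35), (91, 1, 5), (117, 1, 1), (122, 1, 2)]]

/-- Representatives of the admissible multisets of dimension `8`. -/
def tables8 : List Table := [
  [(1, 1, 0), (2, 1, 0), (4, 1, 0), (8, 1, 0), (16, 1, 0), (32, 1, 0), (64, 1, 0), (128, 1, 0),
    (30, 1, 0), (254, 1, 254), (166, 1, 0), (229, 1, 93), (157, 1, 0), (106, 1, 23), (171, 1, 45),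
    (49, 1, 0), (87, 1, 9), (217, 1, 5), (210, 1, 2), (109, 1, 1)],
  [(2, 1, 0), (4, 1, 0), (8, 1, 0), (16, 1, 0), (32, 1, 0), (64, 1, 0), (128, 1, 0), (1, 2, 0),
    (14, 1, 0), (58, 1, 0), (94, 1, 0), (99, 1, 0), (119, 1, 75), (157, 1, 154), (167, 1, 53),
    (176, 1, 17), (200, 1, 13), (219, 1, 2), (236, 1, 5), (245, 1, 1)],
  [(1, 1, 0), (2, 1, 0), (4, 1, 0), (8, 1, 0), (16, 1, 0), (32, 1, 0), (64, 1, 0), (128, 1, 0),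
    (15, 1, 0), (74, 1, 0), (80, 1, 0), (110, 1, 0), (115, 1, 0), (119, 1, 58), (176, 1, 192),
    (197, 1, 28), (214, 1, 72), (217, 1, 14), (236, 1, 7), (237, 1, 3), (251, 1, 1)]]

/-- Representatives of the admissible multisets of dimension `9`. -/
def tables9 : List Table := [
  [(1, 1, 0), (2, 1, 0), (4, 1, 0), (8, 1, 0), (16, 1, 0), (32, 1, 0), (64, 1, 0), (128, 1, 0),
    (256, 1, 0), (60, 1, 0), (99, 1, 95), (175, 1, 0), (213, 1, 0), (218, 1, 156), (315, 1, 273),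
    (333, 1, 26), (342, 1, 13), (421, 1, 39), (434, 1, 3), (459, 1, 1), (508, 1, 4)]]

/-- Certificates for the extensions of `tables0`. -/
def certificates0 : List (List ℕ) := [
  [64, 65, 66]]

/-- Certificates for the extensions of `tables1`. -/
def certificates1 : List (List ℕ) := [
  [576, 577, 578, 451, 580, 581],
  [582, 583],
  []]

/-- Certificates for the extensions of `tables2`. -/
def certificates2 : List (List ℕ) := [
  [17472, 22081, 17474, 11843, 29763, 21571, 17475, 22084, 22725, 6341, 10437, 17093, 17605, 9158,
    17479, 17480, 17481, 10313, 26697, 30793, 17482],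
  [26251, 17484, 17485, 17486, 10318, 17487, 17488, 10320],
  [17489],
  [22673, 26706, 30803],
  [],
  [],
  [17492],
  []]

/-- Certificates for the extensions of `tables3`. -/
def certificates3 : List (List ℕ) := [
  [2164800, 2164801, 2704578, 431298, 2180290, 2966722, 2643138, 2737346, 2688194, 2118850,
    2905282, 2950338, 2163906, 2999490, 2213058, 3334275, 3280003, 3277955, 1237123, 1761411,
    1707139, 1180803, 1182851, 1705091, 3203203, 3170435, 2198659, 2163843, 2165891, 2196611,
    1630339, 1073283, 1106051, 1597571, 1083268, 591748, 1902468, 1068932, 1099652, 853892,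
    2164612, 3196293, 462213, 3458437, 2147717, 3165573, 3179909, 3212677, 3427717, 2116997,
    3442053, 2131333, 3474821, 2164101, 2164806, 2136134, 2137158, 2689094, 2951238, 2660422,
    2923590, 2922566, 2661446, 2197574, 2213958, 694342, 711750, 710726, 695366, 2721862, 3000390,
    2984006, 2738246, 2164807, 2164808, 3737672, 1280072, 2689096, 3475528, 1263688, 1094728,
    1089609, 2164809, 3448905, 3186761, 1181769, 1237065, 1220681, 3541065, 3278921, 3317833,
    3579977, 3334217, 3596361, 2164810, 2136138, 2137162, 2689098, 2951242, 2922570, 2661450,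
    2660426, 2923594, 2197578, 2213962, 710730, 695370, 694346, 711754, 2984010, 2738250, 2721866,
    3000394],
  [397451, 2117771, 3110988, 2904203, 2051148, 3525708, 2125963, 3001420, 2117005, 413069,
    2379149, 3295886, 2118029, 414093, 2380173, 3311695, 2000975, 2738255, 3317839, 3000400,
    2007119, 2744399, 3246161, 1771601, 2721873, 3000402, 2019410, 3002450, 3330130, 2735185],
  [2164819, 2164820, 1181780, 3803220, 4065364, 2164821, 1089620, 3711060, 3973204, 761940,
    778324, 2164822],
  [2705623, 2704599, 2436312, 1207512, 2692312, 2430168, 3953880, 3970264, 4064404, 2164825,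
    1181785, 4067476, 3803226, 4065370, 3803227, 3311707, 3328091, 3573851, 3590235, 2164828,
    2014297, 2178137, 2177113, 2013273, 2165852, 3803229, 3803230, 4065374, 3311710, 3328094,
    3805278, 4067422, 3737695, 3313758, 3330142, 1280095, 4005983, 3743839, 2039903, 2056287],
  [2721888, 2066529, 3000417, 3786849, 3836002, 2000994, 3000419, 2738274, 3770468, 2721892,
    1804388, 3000421],
  [1290342],
  [2560166, 2592934, 2437286, 2439334, 3543206, 4067494, 3805287],
  [],
  [],
  [],
  [],
  [2164840, 2136169, 2137193, 1613929, 1876073, 3842153, 3858537, 2660458],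
  [],
  [],
  [],
  [],
  [],
  [],
  [],
  [],
  []]

/-- Certificates for the extensions of `tables4`. -/
def certificates4 : List (List ℕ) := [
  [1090785344, 549588161, 1019350209, 155454657, 625216705, 679611585, 675548353, 608439489,
    1015155905, 434244801, 1023675585, 419695809, 300027073, 683805889, 616697025, 681708737,
    614599873, 423890113, 547491009, 558107841, 1017253057, 1011092673, 612502721, 545393857,
    541330625, 688131265, 367135937, 151260353, 1373768897, 1376587842, 437063746, 1090785346,
    1560547394, 1116540994, 1229197378, 1564741698, 311234626, 1217204290, 1235488834, 1101271106,
    1351422018, 1371803714, 1237585986, 1103368258, 1577914434, 1573130306, 302846018, 1359220802,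
    1225003074, 1363415106, 1988956226, 1094979650, 579670082, 1369706562, 1082986562, 1552748610,
    1571033154, 887360899, 285347203, 551816579, 285412739, 287382915, 545394051, 876875139,
    880938371, 541330819, 608439683, 1682181507, 545459587, 543427971, 881003907, 610536835,
    612441475, 570690947, 880876931, 1711541635, 271129987, 287444355, 287509891, 618925443,
    285285763, 1692667267, 612502915, 1686244739, 612568451, 878972291, 1686310275, 1684278659,
    545332611, 906235267, 637799811, 1686183299, 1090785348, 1485312068, 1493438532, 1082658884,
    1359220804, 1292111940, 1103368260, 302518340, 1506021444, 308435012, 302714948, 1099173956,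
    1283610692, 1367609412, 1484937284, 1097076804, 1082855492, 1298403396, 1485508676,
    1351094340, 1283985476, 308809796, 273897540, 1371803716, 302143556, 1304694852, 309006404,
    1501827140, 1082284100, 1350719556, 1300500548, 1499729988, 1284182084, 1365512260,
    1351290948, 1090785349, 1560547397, 311169093, 1250693189, 1367609413, 1351356485, 1217138757,
    1568936005, 1365512261, 1712066629, 571215941, 1097076805, 1359220805, 1225003077, 1371803717,
    1237585989, 512495685, 1103368261, 1116475461, 1573130309, 1552683077, 1233391685, 1099173957,
    1082921029, 1376522309, 1231294533, 302780485, 1566838853],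
  [114655878, 1479901830, 473268870, 137724550, 1520534150, 513901190, 178356870, 1484882566,
    478249606, 142705286, 1413579398, 272728710, 876708486, 1521486470, 514853510, 179309190,
    1485834886, 479201926, 143657606, 1414531718, 273681030, 877660806, 1510214278, 503581318,
    168036998, 1442974342, 302123654, 906103430, 1088686726, 1078200966, 1082264198, 1101138566,
    1090785351, 1082658887, 1103630407, 1090785352, 302518343, 973606983, 1510477895, 1980239943,
    570691656, 1778651208, 1845760072, 546312264, 1754271816, 1821380680, 584061000, 1792020552,
    1859129416, 586158152, 1794117704, 1861226568, 545423432, 1753382984, 1820491848, 583172168,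
    1791131720, 1858240584, 585269320, 1793228872, 1860337736, 542539848, 1750499400, 1817608264,
    542605384, 1750564936, 1817673800, 190218312, 192315464, 190283848, 192381000, 1090785353],
  [157551622, 143330310, 887360518, 954469382, 369169098, 338694858, 408423114, 453118666,
    1140329162, 1623265994, 1084361418, 1659900618, 2113999562, 2083525322, 1549273802,
    1593969354, 406947787, 1376524235, 1824723468, 563089355, 337799115, 1071845900, 847349707,
    145756107, 1090676683, 80484299, 339838923, 571217867, 2026050060, 1368395723, 404907979,
    570757067, 406095819, 1014960652, 1090664395, 80496587, 1855094861, 1515814989, 1985577037,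
    1090785358, 1999798349, 1530036301, 1878622285, 961560655, 973750351, 1494450255, 1516798031,
    1103646799, 701005903, 1322270799, 716406863, 1431322703, 1443512399, 823361615, 845709391,
    1787986000, 2048368720, 1309155409, 1727041616, 1918154832, 1401983056, 1607630928,
    1264033872, 1127528528, 2036613201, 1922203728, 1712824400, 772284497, 2062585936, 1783937104,
    1377603664, 1583251536, 2022391889, 1117370448, 1257939024],
  [1350778962, 1024799059, 1367556178, 1695814674, 1054202195, 1024842067, 330684755, 282450259,
    81123667, 129358163, 487960915, 152416595, 329416788, 295862356, 1115840597, 293783637,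
    306344020, 1126326357, 1514301524, 1581410388, 1608679508, 1505919060, 1573027924, 1541570644,
    293765206, 327319638, 587364439, 1115842647, 308441174, 2126669911, 583170135, 1583505494,
    1090658392, 1516396630, 1608679510, 1505919062, 1573027926, 1541570646, 1115842649, 302149722,
    1126328409, 564306009, 293771354, 331520090, 1470273626, 1438816346, 1371707482, 1403164762,
    1375887450, 1442996314, 310538331, 1115842651, 302149724, 2061658203, 585265243, 331518044,
    295866460, 1401065564, 1371705436, 1438814300, 1468174428, 1375889500, 1090658397, 1442998364],
  [1090785374, 1078935646, 570691678, 540715231, 1426983135, 1426917599, 581830879, 581765343,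
    595857504, 1896091744, 956596321, 1933869153, 2003075169, 1935966305, 2000978017, 592453729,
    1762664545, 594550881, 1829773409, 542826592, 542828640, 1778917474],
  [887360543, 551816223, 564268383, 559816931, 704915683, 570697955, 1103904868, 1402853537,
    1848680609, 1991540897, 1130096801, 1493860452, 822771812, 1095245925, 1515249766, 1738444902,
    1913827430, 2052106342, 1783670886, 1712500838, 584417380, 1913895015, 1599725671, 1341966439,
    1721210983, 846221412, 1517310052],
  [],
  [],
  [],
  [],
  [],
  [1447698600, 1820489833, 1820487786, 1493332074, 1493358698, 1950931050, 1950904426, 1753378923,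
    973658218],
  [1913131240, 1698918764, 321942509, 723743084, 679047532, 1687188461, 1711567853, 1161693354,
    732369006, 1204357290, 687673454, 1967591534, 2049509546, 1980239983, 1961496686, 1859002538,
    492638318, 531239022, 1533943978, 1507532970, 685510768, 730206320, 1641381998, 1655603310,
    1900417136, 991264878, 572264561, 993362032, 985170030, 1460568174, 1708490864, 1440252014,
    1722712176],
  [1792180338, 1955362931],
  [1148215923, 1167071859, 264397427, 262293810, 705175668, 1551296818, 1551034674, 262322482,
    220391730, 1563826482, 1563564338, 1605769522, 1605507378],
  [],
  [],
  [],
  [],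
  [],
  [],
  [],
  [],
  [1065814174, 1132726430, 143619181, 894399597, 1901032557, 674504355, 1912676510, 1016924318,
    1090324638, 1009787038, 179270765, 1442319469, 301468781, 286164077, 321784941, 1462635629,
    1427014765, 722340973, 722371693, 1352863395, 1442350189, 301499501, 286133357, 321815661,
    1462666349, 1426984045, 377560739, 1686205549, 546337901, 545354861, 1687188589, 1632662637,
    1631679597, 1015137389, 1050788973, 1051772013, 1016120429, 1721857133, 581989485, 581006445,
    1722840173, 703073389, 704187501, 1346637475, 1080299171, 677645987, 1084362403, 683151011,
    681709219, 1085804195, 703104109, 704218221, 1392774819, 1090785397, 1422397557, 684728437,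
    1750081653, 1955074165, 1887965301, 1817190517, 1778651254, 1845760118, 570564725, 1424494709,
    686825589, 1090662518, 457347190, 524456054, 285380726, 591540341, 591542389, 593637493,
    593639541, 1466183797, 1466185845, 1464086645, 1464088693, 1090664566, 459444342, 526553206,
    1829113973, 1762070645, 1762005109, 1829179509, 1758597238, 1825706102, 546443382, 570822774,
    570888310, 1913004149, 1980178549, 1980113013, 1913069685, 1760694390, 1827803254, 1079652469,
    681193589, 681259125, 1079718005, 995135606, 995201142, 2031128694, 2098303094, 2098237558,
    2031194230, 1090785399, 1079654517, 681195637, 681261173, 1079720053, 997298294, 997232758],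
  [643281074, 790427768, 436879481, 790618232, 792715384, 639086770, 792524920, 773107832,
    1150056627, 808525235, 773234808, 614248626, 1150247091, 222133299],
  [],
  [],
  [],
  [],
  [],
  [],
  [],
  [],
  [],
  [],
  [],
  [],
  [],
  [],
  [],
  [],
  [],
  []]

/-- Certificates for the extensions of `tables5`. -/
def certificates5 : List (List ℕ) := [
  [2207680829248, 2551278212928, 2826156119872, 3238472980288, 584183191360, 790341621568,
    2851925923648, 3264242784064, 593846867776, 800005297984, 2243114309440, 2586711693120,
    554588182336, 760746612544, 2822330914624, 3234647775040, 557809407808, 763967838016,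
    2825552140096, 3237869000512, 590021662528, 796180092736, 2857764394816, 3270081255232,
    325881173824, 532039604032, 2593623906112, 3830574487360, 2216338399297, 2207882682433,
    2227210035265, 2207684501569, 2227011854401, 2207986491457, 2227313844289, 584385044545,
    1821335625793, 2920847253569, 3951639404609, 584186863681, 1821137444929, 2920649072705,
    3951441223745, 584488853569, 1821439434817, 2920951062593, 3951743213633, 554591854657,
    1791542435905, 2891054063681, 3921846214721, 573919207489, 1810869788737, 2910381416513,
    3941173567553, 591099076673, 1828049657921, 2927561285697, 3958353436737, 607205204033,
    1844155785281, 2943667413057, 3974459564097],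
  [3536007995458, 3512704442434, 3535957663810, 3515925667906, 3512385675330, 3515556569154,
    3584208939907, 1722340612995, 1474785450948, 1101072452483, 3584201198467, 2006901984131,
    1721283648387, 1477956344772, 1130667461507, 3590646406019, 1474282134468, 1997195975555,
    1445794421700, 1477503359940, 1101072968579, 1130667977603, 4356188162947, 1445744090052,
    1995082046339, 1722332613507, 1721275648899, 2216338399301, 4005232648261, 1065422438470,
    584387936326, 2105881428038, 2771464503365, 309510045766, 1418683605062, 1392259489862,
    2079457312838, 2757723963461, 309508239430, 1418689282118, 2216337883205, 1065421406278,
    2125208780870, 1438016634950, 2768241213509, 3990197928005, 1392265166918, 4005225422917,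
    584385097798, 1438010957894, 3990194573381, 2783499059269, 996702961735, 2216338399304,
    292200390728, 980092485703, 877389717576, 3994665943111, 996701929543, 309509783623,
    292192649288, 4176485154888, 1016029282375, 1392265732168, 1436943155271, 292900339783,
    2251774009416, 2826439295047, 980093517895, 1016030314567, 328837136455, 2216896307272,
    2192854515783, 877384040520, 1392262119496, 1026770964551, 1439086252103],
  [1452857861769, 142960993929, 1453041886857, 345763980937, 1192945231497, 1598936557193,
    409230354057, 641041933961, 1173752096393, 1109261526665, 1598886749833, 1444569917065,
    4200545625737, 1176888649353, 1581657597577, 2216338399306, 4003044794442, 1413179514954,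
    4363956265034, 4024519630922, 927982428234, 2216338399307, 1128868618315, 324812415051,
    3169961648203, 2523843797067, 1959282352203, 2496652124235, 3582276673611, 3527450566731,
    3165866172491, 2482760589386, 4338186461258, 1442170544202, 2536447680586, 2266804265034,
    955899715658, 330245873739, 3200622796875, 2482760589387, 1963658846283, 1128720506955,
    3522014748747, 2504036196427, 2212261535819, 4338188558411, 3174340501579],
  [1821336682572, 1834221584460, 3445045084236, 3582450483276, 3598189174860, 1147194589260,
    1991865102412, 1134309687372, 1977906458700],
  [],
  [],
  [589518869517, 790542960078, 603463886286, 2182951736782, 3265048102350, 3283268675022,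
    773124007374, 760255616462, 808797087182, 790291301838, 2229678907727, 3265014547918,
    3283302229454, 3901777520078, 3883489838542, 589602755597, 1133906761421, 808545428942,
    602403771854, 2184011851214, 3901743965646, 3883523392974, 192848986192, 199390572624,
    172172017745, 1965188251729, 1958744395857, 161306181713, 172037800017, 2216338399314,
    1941702738001, 1959147049041, 193821827152, 205814677584, 1948834725969, 1942390603857],
  [],
  [],
  [],
  [4233835341139, 4020459038035, 829197662228, 342189676693, 584486233427, 591700493651,
    1172778023061, 875369075350, 4265156024469, 2207631025491, 2688672138579, 1828649706835,
    1821435561299, 916023154837, 2148324610766, 4226621117779, 3607638581966, 4027673220435,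
    1133737677518, 2227042321747, 1457179859093, 2708083320147, 1182290856085, 1619999584343,
    2775147835480, 2539139493975, 1877578121304, 4162628481111, 2913594241111, 3801719341144,
    2214326190169, 576127418456, 2216338399322, 3470686994521, 1434271711320, 996787896409,
    1658099515480, 2219627876441, 3393615118424, 1009598693464, 3349617938519, 1125873934424,
    2232738324567, 1150588231767, 3282372759639, 1902945439832, 3038834163800, 1370232995929,
    1702810697816, 3500533678169, 281832263770],
  [2383163555931, 2371353473115, 2383161749595, 1287957545052, 4333892665437, 1255162339422,
    3278091231326, 1287955480668, 1254679674972, 1255159758942, 3278094585950, 1272338014302,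
    3261989036126],
  [2132292116637, 1788789018908, 2201125232924, 2407634321503, 4124680802588, 2063587319965,
    2544703217948, 1101789016159, 4193503519004, 3232503988320, 4124865306908, 2201963495520,
    4193402880284, 2132312830109, 2200562811164, 2063637639325, 1857518960924, 2544132931868,
    2407603925087, 1788403237148, 1101742866527, 2407399497823, 1857049313564, 2201309343840,
    2407452967007],
  [],
  [],
  [],
  [],
  [],
  [2539941068897, 2608660545633, 325885427809, 1727315841312, 340917756001, 2216338399330,
    1155639672987, 1155639681179, 330955620507, 330955628699, 2524908626017, 2593628102753,
    595274244195, 1154693734499, 2539941072993, 2608660549729, 325885431905, 306558074977,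
    2255382446235, 2392821399707, 316993179803, 2489475203169, 2558194679905, 77371380000,
    2505581273185, 2574300749921, 290451890273, 1108901728544, 1383779635488, 306558079073,
    2378861920411, 2241422966939, 110884307099, 2489475207265, 2558194684001],
  [1569588117662, 1557727531166, 999463813403, 353201279132, 1575253770340, 664423837854,
    3087548842085, 1002833162401, 673062834334, 3038838653029, 1016759308449, 1542892261476,
    2216338399334, 1203573862561, 1234365464737, 2228805161116, 2243498901660, 1578078478494,
    1563194765470, 1959498059877, 967366443108, 1941525266533, 1940136374373, 998654578788,
    1991940288613, 1008830120219, 1207687696545, 1232433184929, 1234613174555, 1215434555675,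
    409341296796, 1024902709409, 1936497832037, 673789157534, 1013158117537, 3092261175397,
    669659824286],
  [],
  [],
  [],
  [],
  [],
  [],
  [],
  [],
  [],
  [],
  [],
  [],
  [],
  [],
  [],
  [2216338399335],
  [],
  [],
  [],
  [],
  [],
  [],
  [],
  [],
  [2216338399336],
  [],
  [],
  [],
  [],
  [],
  [],
  [],
  [],
  [],
  [],
  [],
  [],
  []]

/-- Certificates for the extensions of `tables6`. -/
def certificates6 : List (List ℕ) := [
  [2262320203966272, 24990508268922688, 24989775305910080, 2471777169057600, 24780318340818752,
    2472510132070208, 1372379691488833, 18086073193240129, 1196304101807681, 18287353214809665,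
    18287199803946561, 18084811815032385, 21528575252403777, 2322205069293121, 2524609158092353,
    21638578904241729, 2525785308042817, 21462501535389249, 2322443708413505, 21528455932843585,
    4640077047150145, 18085043209519170, 20899553543782466, 838929409441858, 21045754238926914,
    20899792182902850, 20913106842673218, 1401879481475138, 23357460256456770, 18098358545580098,
    20912782975295554],
  [],
  [2268539344928832, 9018031211561024, 21971961813942336, 28164409288310848, 18186048893067328,
    16623932558819392, 4576116887330179, 24891724021120387, 4592196478115203, 30525603481410947,
    11386198961446275, 27706490028572035, 9129125727976835, 24896088109505923, 27710838010830211,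
    30471178322779523, 30521224092204419, 16062302545845635, 9133489011056003, 15608327772855683,
    24910810589445507, 18085043209519172, 29343843653533764, 24278979437412420, 34376609276395588,
    31560932595368004, 28747119808512068, 4575729322836036, 34415076609900612, 31601751440244804,
    9043869693935684, 24253072213573700, 21720338691817540, 34412068801101892, 31595842896937028,
    34410398334599236, 18050134518562884, 21748701852614724, 31571424023969860, 34386711838490692,
    31573009244389444],
  [32938533865038597, 19820514407186502, 16642920971075654, 18085043209519175, 19844056733712454,
    35791749514330183, 17400080495747144, 19738647498924102, 12100431497076808, 23029223882309704,
    6694538286563398, 23077278929363016, 30259266527002694, 2480781704347719, 30337938114289734,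
    29408935219888200, 30234452890484806, 35559605815803976],
  [18272851928818693, 9155405024428101, 18364799393997829, 350323310887941, 5980248990581765,
    18085043209519177, 1968923268366409, 29414425249292362, 32850849789182086, 32850213099143302,
    28345556660256902, 26037000406630474, 18647856799825993, 13228035961069641, 1406092636602441,
    29271274455375945, 13371811866075210, 1324834323759238, 2394283809210442, 3576008067735686,
    14145888184221769, 14144840016134217, 28346322449383558, 3801368912494666, 15116365040025734,
    15116226401886342, 20618082630303817, 14988693775368265, 16805487626518662, 9205393406869638],
  [],
  [],
  [],
  [],
  [18085043209519179, 20240092044361995, 33008079956118795],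
  [],
  [],
  [],
  [],
  [],
  [],
  [],
  [],
  [],
  [18085043209519180],
  [2368431329280139],
  [11848418235518412, 22378824681983436, 11848896721489356, 22378502022720972],
  [12224926066955980, 2410616312572684, 20552627136165580, 2278930629530188, 9148253111484939,
    9034843887277772, 1218543588748044, 34514156820712204, 12478495104655628, 7977094500532492,
    25650149790233164, 15485602708014092, 25403844154274380],
  [],
  [],
  [],
  [],
  [],
  [],
  [],
  [],
  [],
  [],
  [],
  [],
  [],
  [],
  [],
  [],
  [],
  []]

/-- Certificates for the extensions of `tables7`. -/
def certificates7 : List (List ℕ) := [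
  [1002307623402633970176, 766427088469023490176, 506814347820233359488, 1058908862677579268224,
    491155613486434762880, 591450988069779439681, 78050794435030057025, 1133040250531598073921,
    922920656786331566145, 1090145862126466531393, 1014381157158230196289, 1131651052160103252033,
    22710544827924119617, 297470989845217181761, 811909289857232437313],
  [],
  [],
  [591450988069779439682, 812998820736863863042, 590370152471886594114, 815514076526722194626],
  [],
  [74057331669973860482, 343572860702076043394, 77338065824046645378, 341551727762689097858,
    344436386648048140418, 372802416682943643778, 345133778316040470658, 76100976856804884610],
  [],
  [],
  [],
  [],
  [],
  [],
  []]

/-- Certificates for the extensions of `tables8`. -/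
def certificates8 : List (List ℕ) := [
  [77446884178166507911577664, 18390112714983069643243584, 66072514632675894778462272,
    138980540466944488897577024],
  [],
  []]

theorem certifyTables_tables0 : certifyTables 0 tables0 = true := by decide +kernel

theorem certifyTables_tables1 : certifyTables 1 tables1 = true := by decide +kernel

theorem certifyTables_tables2 : certifyTables 2 tables2 = true := by decide +kernel

theorem certifyTables_tables3 : certifyTables 3 tables3 = true := by decide +kernel

theorem certifyTables_tables4 : certifyTables 4 tables4 = true := by decide +kernel

theorem certifyTables_tables5 : certifyTables 5 tables5 = true := by decide +kernel

theorem certifyTables_tables6 : certifyTables 6 tables6 = true := by decide +kernel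

theorem certifyTables_tables7 : certifyTables 7 tables7 = true := by decide +kernel

theorem certifyTables_tables8 : certifyTables 8 tables8 = true := by decide +kernel

theorem certifyTables_tables9 : certifyTables 9 tables9 = true := by decide +kernel

theorem certifyExtensions_tables0 : certifyExtensions 0
    (tables1.map fun R => encode (fullTable R)) tables0 certificates0 = true := by decide +kernel

theorem certifyExtensions_tables1 : certifyExtensions 1
    (tables2.map fun R => encode (fullTable R)) tables1 certificates1 = true := by decide +kernel

theorem certifyExtensions_tables2 : certifyExtensions 2
    (tables3.map fun R => encode (fullTable R)) tables2 certificates2 = true := by decide +kernel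

theorem certifyExtensions_tables3 : certifyExtensions 3
    (tables4.map fun R => encode (fullTable R)) tables3 certificates3 = true := by decide +kernel

theorem certifyExtensions_tables4 : certifyExtensions 4
    (tables5.map fun R => encode (fullTable R)) tables4 certificates4 = true := by decide +kernel

theorem certifyExtensions_tables5 : certifyExtensions 5
    (tables6.map fun R => encode (fullTable R)) tables5 certificates5 = true := by decide +kernel

theorem certifyExtensions_tables6 : certifyExtensions 6
    (tables7.map fun R => encode (fullTable R)) tables6 certificates6 = true := by decide +kernel

theorem certifyExtensions_tables7 : certifyExtensions 7
    (tables8.map fun R => encode (fullTable R)) tables7 certificates7 = true := by decide +kernel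

theorem certifyExtensions_tables8 : certifyExtensions 8
    (tables9.map fun R => encode (fullTable R)) tables8 certificates8 = true := by decide +kernel

theorem exhausts_tables0 : Exhausts 0 tables0 := exhausts_zero

theorem exhausts_tables1 : Exhausts 1 tables1 :=
  exhausts_tables0.succ (represents_of_certifyTables certifyTables_tables0).1
    (represents_of_certifyTables certifyTables_tables1).1 certifyExtensions_tables0

theorem exhausts_tables2 : Exhausts 2 tables2 :=
  exhausts_tables1.succ (represents_of_certifyTables certifyTables_tables1).1
    (represents_of_certifyTables certifyTables_tables2).1 certifyExtensions_tables1

theorem exhausts_tables3 : Exhausts 3 tables3 :=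
  exhausts_tables2.succ (represents_of_certifyTables certifyTables_tables2).1
    (represents_of_certifyTables certifyTables_tables3).1 certifyExtensions_tables2

theorem exhausts_tables4 : Exhausts 4 tables4 :=
  exhausts_tables3.succ (represents_of_certifyTables certifyTables_tables3).1
    (represents_of_certifyTables certifyTables_tables4).1 certifyExtensions_tables3

theorem exhausts_tables5 : Exhausts 5 tables5 :=
  exhausts_tables4.succ (represents_of_certifyTables certifyTables_tables4).1
    (represents_of_certifyTables certifyTables_tables5).1 certifyExtensions_tables4

theorem exhausts_tables6 : Exhausts 6 tables6 :=
  exhausts_tables5.succ (represents_of_certifyTables certifyTables_tables5).1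
    (represents_of_certifyTables certifyTables_tables6).1 certifyExtensions_tables5

theorem exhausts_tables7 : Exhausts 7 tables7 :=
  exhausts_tables6.succ (represents_of_certifyTables certifyTables_tables6).1
    (represents_of_certifyTables certifyTables_tables7).1 certifyExtensions_tables6

theorem exhausts_tables8 : Exhausts 8 tables8 :=
  exhausts_tables7.succ (represents_of_certifyTables certifyTables_tables7).1
    (represents_of_certifyTables certifyTables_tables8).1 certifyExtensions_tables7

theorem exhausts_tables9 : Exhausts 9 tables9 :=
  exhausts_tables8.succ (represents_of_certifyTables certifyTables_tables8).1
    (represents_of_certifyTables certifyTables_tables9).1 certifyExtensions_tables8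

end ColumnMultiset

theorem theorem1p4 {Z : Type*} [Fintype Z] [DecidableEq Z] (hZ : Fintype.card Z = 21) :
    Code.r Z 1 = 1 ∧ Code.r Z 2 = 3 ∧ Code.r Z 3 = 13 ∧ Code.r Z 4 = 41 ∧ Code.r Z 5 = 58 ∧
    Code.r Z 6 = 43 ∧ Code.r Z 7 = 21 ∧ Code.r Z 8 = 8 ∧ Code.r Z 9 = 3 ∧ Code.r Z 10 = 1 := by
  open ColumnMultiset in
  exact ⟨r_eq_of_exhausts hZ rfl exhausts_tables9 certifyTables_tables9,
    r_eq_of_exhausts hZ rfl exhausts_tables8 certifyTables_tables8,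
    r_eq_of_exhausts hZ rfl exhausts_tables7 certifyTables_tables7,
    r_eq_of_exhausts hZ rfl exhausts_tables6 certifyTables_tables6,
    r_eq_of_exhausts hZ rfl exhausts_tables5 certifyTables_tables5,
    r_eq_of_exhausts hZ rfl exhausts_tables4 certifyTables_tables4,
    r_eq_of_exhausts hZ rfl exhausts_tables3 certifyTables_tables3,
    r_eq_of_exhausts hZ rfl exhausts_tables2 certifyTables_tables2,
    r_eq_of_exhausts hZ rfl exhausts_tables1 certifyTables_tables1,
    r_eq_of_exhausts hZ rfl exhausts_tables0 certifyTables_tables0⟩
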